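/- Let $N$ be a lattice of rank $2$ with basis $e_1,e_2$ and a skew-symmetric bilinear form $\{\cdot,\cdot\}\colon N\times N\to\mathbb{Q}$, and let $N^+=\{a_1e_1+a_2e_2 : a_1,a_2\in\mathbb{Z}_{\ge0},\ a_1+a_2>0\}$. Let $\Bbbk$ be a field of characteristic $0$, and let $\mathfrak g=\bigoplus_{n\in N^+}\Bbbk X_n$ be the Lie algebra with bracket $[X_n,X_{n'}]=\{n,n'\}X_{n+n'}$. For a subset $L\subset N^+$ with $N^++L\subset L$ and $N^+\setminus L$ finite, let $\mathfrak g_L=\mathfrak g/\bigoplus_{n\in L}\Bbbk X_n$, a nilpotent Lie algebra, and let $G_L=\{\exp_L(X) : X\in\mathfrak g_L\}$ be the group whose product is given by the Baker–Campbell–Hausdorff formula. Let $\hat{\mathfrak g}=\varprojlim_L\mathfrak g_L$ and $G=\varprojlim_L G_L$, with the induced bijection $\exp\colon\hat{\mathfrak g}\to G$. For $n\in N^+$ put $$[n]=\exp\Bigl(\sum_{j>0}\frac{(-1)^{j+1}}{j^2}X_{jn}\Bigr)\in G,$$ and for $g=\exp(X)\in G$ and $c\in\mathbb{Q}$ put $g^c=\exp(cX)$.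 Infinite products in $G$ are understood as limits of finite products, where convergence means that the image in each $G_L$ is eventually constant; $\prod^{\to}_{p\ge0}a_p=a_0a_1a_2\cdots$ and $\prod^{\leftarrow}_{p\ge0}a_p=\cdots a_2a_1a_0$, while in a product without an arrow the order of the factors does not matter. Theorem. Let $n,n'\in N^+$ and $c\in\mathbb{Q}\setminus\{0\}$ with $\{n',n\}=c^{-1}$. Then the infinite products below converge in $G$, and $$\begin{aligned}[n']^c[n]^{4c}={}&\prod_{p\ge0}^{\longrightarrow}\bigl([(2p+1)n+pn']^{4c}\,[(4p+4)n+(2p+1)n']^{c}\bigr)\\&\times[2n+n']^{2c}\prod_{p\ge0}[2^p(2n+n')]^{4c/2^p}\\&\times\prod_{p\ge0}^{\longleftarrow}\bigl([(2p+1)n+(p+1)n']^{4c}\,[4pn+(2p+1)n']^{c}\bigr).\end{aligned}$$ -/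

import Mathlib

namespace ClusterScattering

/-! ### The Baker–Campbell–Hausdorff product of a nilpotent Lie algebra -/

section BCH

/-- Right-nested bracket of a word: `[x₁, [x₂, [⋯, [x_{r-1}, x_r]]]]`. -/
def nestedBracket {𝔫 : Type*} [LieRing 𝔫] : List 𝔫 → 𝔫
  | [] => 0
  | [x] => x
  | x :: y :: l => ⁅x, nestedBracket (y :: l)⁆

/-- The word `X^{r₁} Y^{s₁} ⋯ X^{r_k} Y^{s_k}`, where `e i = (r_i, s_i)`. -/
def dynkinWord {𝔫 : Type*} {k : ℕ} (e : Fin k → ℕ × ℕ) (X Y : 𝔫) : List 𝔫 :=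
  (List.ofFn fun i => List.replicate (e i).1 X ++ List.replicate (e i).2 Y).flatten

/-- The sequences `((r₁, s₁), …, (r_k, s_k))` of pairs of natural numbers with `r_i + s_i > 0`
for all `i` and with total degree `∑ (r_i + s_i) = m`. -/
def dynkinIndex (k m : ℕ) : Finset (Fin k → ℕ × ℕ) :=
  (Fintype.piFinset fun _ => Finset.range (m + 1) ×ˢ Finset.range (m + 1)).filter fun e =>
    (∀ i, 0 < (e i).1 + (e i).2) ∧ ∑ i, ((e i).1 + (e i).2) = m

/-- The component of degree `m` of the Baker–Campbell–Hausdorff series, by Dynkin's formula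
`∑_k (-1)^{k+1}/k ∑ [X^{r₁} Y^{s₁} ⋯ X^{r_k} Y^{s_k}] / (m ∏ r_i! s_i!)`. -/
noncomputable def bchTerm (𝕜 : Type*) {𝔫 : Type*} [Field 𝕜] [LieRing 𝔫] [LieAlgebra 𝕜 𝔫]
    (m : ℕ) (X Y : 𝔫) : 𝔫 :=
  ∑ k ∈ Finset.Icc 1 m, ∑ e ∈ dynkinIndex k m,
    ((-1 : 𝕜) ^ (k + 1) /
      ((k : 𝕜) * (m : 𝕜) * ∏ i, (((e i).1.factorial : 𝕜) * ((e i).2.factorial : 𝕜)))) •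
        nestedBracket (dynkinWord e X Y)

/-- The Baker–Campbell–Hausdorff series
`X + Y + ½[X,Y] + (1/12)[X,[X,Y]] - (1/12)[Y,[X,Y]] + ⋯`. It is used for nilpotent Lie algebras
only, where the sum is finite (`bchTerm_eq_zero`). -/
noncomputable def bch (𝕜 : Type*) {𝔫 : Type*} [Field 𝕜] [LieRing 𝔫] [LieAlgebra 𝕜 𝔫]
    (X Y : 𝔫) : 𝔫 :=
  ∑ᶠ m : ℕ, bchTerm 𝕜 m X Y

theorem length_dynkinWord {𝔫 : Type*} {k m : ℕ} {e : Fin k → ℕ × ℕ} (he : e ∈ dynkinIndex k m)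
    (X Y : 𝔫) : (dynkinWord e X Y).length = m := by
  have h := ((Finset.mem_filter.1 he).2).2
  rw [← h]
  simp [dynkinWord, List.length_flatten, List.map_ofFn, List.sum_ofFn, Function.comp_def]

theorem nestedBracket_mem_lcs (𝕜 : Type*) {𝔫 : Type*} [Field 𝕜] [LieRing 𝔫] [LieAlgebra 𝕜 𝔫] :
    ∀ (l : List 𝔫) (k : ℕ), l.length = k + 1 →
      nestedBracket l ∈ LieModule.lowerCentralSeries 𝕜 𝔫 𝔫 k
  | [], k, h => by simp at h
  | [x], k, h => by
      obtain rfl : k = 0 := by simpa using h.symm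
      simp
  | x :: y :: l, k, h => by
      obtain ⟨j, rfl⟩ : ∃ j, k = j + 1 := ⟨l.length, by simpa using h.symm⟩
      rw [LieModule.lowerCentralSeries_succ]
      exact LieSubmodule.lie_mem_lie (LieSubmodule.mem_top x)
        (nestedBracket_mem_lcs 𝕜 (y :: l) j (by simpa using h))

theorem bchTerm_eq_zero (𝕜 : Type*) {𝔫 : Type*} [Field 𝕜] [LieRing 𝔫] [LieAlgebra 𝕜 𝔫]
    [LieRing.IsNilpotent 𝔫] : ∃ K, ∀ m, K < m → ∀ X Y : 𝔫, bchTerm 𝕜 m X Y = 0 := by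
  obtain ⟨K, hK⟩ := LieModule.IsNilpotent.nilpotent 𝕜 𝔫 𝔫
  refine ⟨K, fun m hm X Y => Finset.sum_eq_zero fun k _ => Finset.sum_eq_zero fun e he => ?_⟩
  obtain ⟨j, rfl⟩ : ∃ j, m = j + 1 := ⟨m - 1, by omega⟩
  have h1 := nestedBracket_mem_lcs 𝕜 (dynkinWord e X Y) j (length_dynkinWord he X Y)
  have h2 := LieModule.antitone_lowerCentralSeries 𝕜 𝔫 𝔫 (show K ≤ j by omega) h1
  rw [hK, LieSubmodule.mem_bot] at h2
  rw [h2, smul_zero]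

theorem finite_support_bchTerm (𝕜 : Type*) {𝔫 : Type*} [Field 𝕜] [LieRing 𝔫] [LieAlgebra 𝕜 𝔫]
    [LieRing.IsNilpotent 𝔫] (X Y : 𝔫) :
    (Function.support fun m => bchTerm 𝕜 m X Y).Finite := by
  obtain ⟨K, hK⟩ := bchTerm_eq_zero 𝕜 (𝔫 := 𝔫)
  refine (Set.finite_Iic K).subset fun m hm => ?_
  by_contra h
  exact hm (hK m (not_le.1 h) X Y)

theorem map_nestedBracket {𝕜 𝔫 𝔫' : Type*} [Field 𝕜] [LieRing 𝔫] [LieAlgebra 𝕜 𝔫] [LieRing 𝔫']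
    [LieAlgebra 𝕜 𝔫'] (f : 𝔫 →ₗ⁅𝕜⁆ 𝔫') :
    ∀ l : List 𝔫, f (nestedBracket l) = nestedBracket (l.map f)
  | [] => by simp [nestedBracket]
  | [x] => by simp [nestedBracket]
  | x :: y :: l => by
      have := map_nestedBracket f (y :: l)
      simp only [List.map_cons] at this
      simp [nestedBracket, this]

theorem map_bchTerm {𝕜 𝔫 𝔫' : Type*} [Field 𝕜] [LieRing 𝔫] [LieAlgebra 𝕜 𝔫] [LieRing 𝔫']
    [LieAlgebra 𝕜 𝔫'] (f : 𝔫 →ₗ⁅𝕜⁆ 𝔫') (m : ℕ) (X Y : 𝔫) :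
    f (bchTerm 𝕜 m X Y) = bchTerm 𝕜 m (f X) (f Y) := by
  simp [bchTerm, map_sum, map_nestedBracket, dynkinWord, List.map_flatten, List.map_ofFn,
    Function.comp_def]

theorem map_bch {𝕜 𝔫 𝔫' : Type*} [Field 𝕜] [LieRing 𝔫] [LieAlgebra 𝕜 𝔫] [LieRing 𝔫']
    [LieAlgebra 𝕜 𝔫'] [LieRing.IsNilpotent 𝔫] (f : 𝔫 →ₗ⁅𝕜⁆ 𝔫') (X Y : 𝔫) :
    f (bch 𝕜 X Y) = bch 𝕜 (f X) (f Y) := by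
  have h := (f : 𝔫 →ₗ[𝕜] 𝔫').toAddMonoidHom.map_finsum (finite_support_bchTerm 𝕜 X Y)
  simp only [LinearMap.toAddMonoidHom_coe, LieHom.coe_toLinearMap] at h
  simp only [bch, h, map_bchTerm]

/-- The group of a nilpotent Lie algebra `𝔫`: it is in bijection with `𝔫` by
`X ↦ exp X := ⟨X⟩`, and its product is given by the Baker–Campbell–Hausdorff formula. -/
@[ext] structure ExpGroup (𝕜 𝔫 : Type*) where
  /-- the bijection `X ↦ exp X` -/
  exp ::
  /-- the inverse of `exp` -/
  log : 𝔫

noncomputable instance ExpGroup.instMul {𝕜 𝔫 : Type*} [Field 𝕜] [LieRing 𝔫] [LieAlgebra 𝕜 𝔫]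
    [LieRing.IsNilpotent 𝔫] : Mul (ExpGroup 𝕜 𝔫) :=
  ⟨fun g h => ExpGroup.exp (bch 𝕜 g.log h.log)⟩

instance ExpGroup.instOne {𝕜 𝔫 : Type*} [LieRing 𝔫] : One (ExpGroup 𝕜 𝔫) :=
  ⟨ExpGroup.exp 0⟩

end BCH

/-! ### The lattice and the graded Lie algebra -/

/-- The structure of a rank 2 lattice with a skew-symmetric `ℚ`-valued bilinear form on an
abelian group `N`, together with a basis `e₁ = basis 0`, `e₂ = basis 1`. -/
structure SkewLattice (N : Type*) [AddCommGroup N] where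
  basis : Module.Basis (Fin 2) ℤ N
  form : N →ₗ[ℤ] N →ₗ[ℤ] ℚ
  skew : ∀ x y, form x y = -form y x

namespace SkewLattice

/-- `N⁺ = {a₁ e₁ + a₂ e₂ ∣ a₁, a₂ ∈ ℤ_{≥ 0}, a₁ + a₂ > 0}`. -/
def Pos {N : Type*} [AddCommGroup N] (D : SkewLattice N) : Type _ :=
  {x : N // ∃ a₁ a₂ : ℕ, 0 < a₁ + a₂ ∧ x = a₁ • D.basis 0 + a₂ • D.basis 1}

section

variable {N : Type*} [AddCommGroup N] {D : SkewLattice N}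

/-- For `n, n' ∈ N⁺` and natural numbers `a, b`, not both zero, the element `a n + b n'`
of `N⁺`. -/
def Pos.comb (n n' : D.Pos) (a b : ℕ) (h : 0 < a + b) : D.Pos :=
  ⟨a • n.1 + b • n'.1, by
    obtain ⟨x, x₁, x₂, hx, rfl⟩ := n
    obtain ⟨y, y₁, y₂, hy, rfl⟩ := n'
    refine ⟨a * x₁ + b * y₁, a * x₂ + b * y₂, ?_, ?_⟩
    · have h1 : a * x₁ + b * y₁ + (a * x₂ + b * y₂) = a * (x₁ + x₂) + b * (y₁ + y₂) := by ring
      rw [h1]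
      rcases Nat.eq_zero_or_pos a with ha | ha
      · have : 0 < b * (y₁ + y₂) := Nat.mul_pos (by omega) hy
        omega
      · have : 0 < a * (x₁ + x₂) := Nat.mul_pos ha hx
        omega
    · simp only [smul_add, add_smul, mul_smul]
      abel⟩

/-- The multiple `j n` of `n ∈ N⁺` for `j > 0`. -/
def Pos.mul (j : ℕ+) (n : D.Pos) : D.Pos :=
  ⟨(j : ℕ) • n.1, by
    obtain ⟨x, x₁, x₂, hx, rfl⟩ := n
    refine ⟨j * x₁, j * x₂, ?_, by simp only [smul_add, mul_smul]⟩
    rw [← mul_add]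
    exact Nat.mul_pos j.pos hx⟩

instance : Add D.Pos :=
  ⟨fun m n => ⟨m.1 + n.1, by
    obtain ⟨x, x₁, x₂, hx, rfl⟩ := m
    obtain ⟨y, y₁, y₂, hy, rfl⟩ := n
    exact ⟨x₁ + y₁, x₂ + y₂, by omega, by simp only [add_smul]; abel⟩⟩⟩

@[simp] theorem Pos.coe_add (m n : D.Pos) : (m + n).1 = m.1 + n.1 := rfl

/-- The form `{m, n}` on `N⁺`. -/
def pform (D : SkewLattice N) (m n : D.Pos) : ℚ := D.form m.1 n.1

/-- The total degree `a₁ + a₂` of `a₁ e₁ + a₂ e₂`. -/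
noncomputable def deg (D : SkewLattice N) (n : D.Pos) : ℤ := D.basis.repr n.1 0 + D.basis.repr n.1 1

theorem deg_add (m n : D.Pos) : D.deg (m + n) = D.deg m + D.deg n := by
  simp only [deg, Pos.coe_add, map_add, Finsupp.add_apply]
  ring

theorem deg_pos (n : D.Pos) : 0 < D.deg n := by
  obtain ⟨x, x₁, x₂, hx, rfl⟩ := n
  simp [deg]
  omega

theorem Pos.mul_injective (n : D.Pos) : Function.Injective fun j : ℕ+ => Pos.mul j n := by
  intro i j h
  have h1 : ((i : ℕ) • n.1 : N) = (j : ℕ) • n.1 := congrArg Subtype.val h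
  have h3 : ∀ k : ℕ, D.basis.repr (k • n.1) 0 + D.basis.repr (k • n.1) 1 = k * D.deg n := by
    intro k
    simp [deg, mul_add]
  have h4 : ((i : ℕ) : ℤ) * D.deg n = ((j : ℕ) : ℤ) * D.deg n := by
    rw [← h3, ← h3, h1]
  have h5 := mul_right_cancel₀ (deg_pos n).ne' h4
  exact PNat.coe_injective (by exact_mod_cast h5)

end

/-- The Lie algebra `𝔤 = ⨁_{n ∈ N⁺} 𝕜 X_n`, as a vector space. -/
noncomputable def LieAlg {N : Type*} [AddCommGroup N] (D : SkewLattice N) (𝕜 : Type*) [Zero 𝕜] : Type _ :=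
  D.Pos →₀ 𝕜

section

variable {N : Type*} [AddCommGroup N] {D : SkewLattice N} {𝕜 : Type*} [Field 𝕜]

noncomputable instance : AddCommGroup (D.LieAlg 𝕜) := inferInstanceAs (AddCommGroup (D.Pos →₀ 𝕜))

noncomputable instance : Module 𝕜 (D.LieAlg 𝕜) := inferInstanceAs (Module 𝕜 (D.Pos →₀ 𝕜))

/-- The basis `(X_n)_{n ∈ N⁺}` of `𝔤`. -/
noncomputable def XBasis (D : SkewLattice N) (𝕜 : Type*) [Field 𝕜] :
    Module.Basis D.Pos 𝕜 (D.LieAlg 𝕜) :=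
  Module.Basis.ofRepr (LinearEquiv.refl 𝕜 (D.Pos →₀ 𝕜))

/-- The basis element `X_n` of `𝔤`. -/
noncomputable def X (𝕜 : Type*) [Field 𝕜] (n : D.Pos) : D.LieAlg 𝕜 := XBasis D 𝕜 n

theorem X_eq_single (n : D.Pos) : X 𝕜 n = (Finsupp.single n 1 : D.Pos →₀ 𝕜) := rfl

/-- The bilinear map with `(X_m, X_n) ↦ {m, n} X_{m+n}`. -/
noncomputable def bracketMap (D : SkewLattice N) (𝕜 : Type*) [Field 𝕜] :
    D.LieAlg 𝕜 →ₗ[𝕜] D.LieAlg 𝕜 →ₗ[𝕜] D.LieAlg 𝕜 :=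
  (XBasis D 𝕜).constr 𝕜 fun m => (XBasis D 𝕜).constr 𝕜 fun n =>
    (D.pform m n : 𝕜) • X 𝕜 (m + n)

theorem bracketMap_X (m n : D.Pos) :
    bracketMap D 𝕜 (X 𝕜 m) (X 𝕜 n) = (D.pform m n : 𝕜) • X 𝕜 (m + n) := by
  simp only [bracketMap, X, Module.Basis.constr_basis]

theorem hom_ext {M : Type*} [AddCommGroup M] [Module 𝕜 M] {f g : D.LieAlg 𝕜 →ₗ[𝕜] M}
    (h : ∀ n, f (X 𝕜 n) = g (X 𝕜 n)) : f = g :=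
  (XBasis D 𝕜).ext h

theorem bracketMap_skew (f g : D.LieAlg 𝕜) : bracketMap D 𝕜 f g = -bracketMap D 𝕜 g f := by
  have : bracketMap D 𝕜 = -(bracketMap D 𝕜).flip := by
    refine hom_ext fun m => hom_ext fun n => ?_
    have h1 : D.pform m n = -D.pform n m := D.skew _ _
    have h2 : m + n = n + m := Subtype.ext (add_comm m.1 n.1)
    simp only [LinearMap.neg_apply, LinearMap.flip_apply, bracketMap_X, h1, h2]
    push_cast
    rw [neg_smul]
  exact LinearMap.congr_fun (LinearMap.congr_fun this f) g

variable [CharZero 𝕜]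

theorem bracketMap_leibniz (f g h : D.LieAlg 𝕜) :
    bracketMap D 𝕜 f (bracketMap D 𝕜 g h) =
      bracketMap D 𝕜 (bracketMap D 𝕜 f g) h + bracketMap D 𝕜 g (bracketMap D 𝕜 f h) := by
  have key : ∀ m : D.Pos, ∀ n : D.Pos,
      (bracketMap D 𝕜 (X 𝕜 m)) ∘ₗ (bracketMap D 𝕜 (X 𝕜 n)) =
        bracketMap D 𝕜 (bracketMap D 𝕜 (X 𝕜 m) (X 𝕜 n)) +
          (bracketMap D 𝕜 (X 𝕜 n)) ∘ₗ (bracketMap D 𝕜 (X 𝕜 m)) := by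
    intro m n
    refine hom_ext fun l => ?_
    have e1 : m + (n + l) = m + n + l := Subtype.ext (add_assoc m.1 n.1 l.1).symm
    have e2 : n + (m + l) = m + n + l := Subtype.ext (by simp only [Pos.coe_add]; abel)
    have h1 : D.pform m (n + l) = D.pform m n + D.pform m l := by simp [pform]
    have h2 : D.pform n (m + l) = -D.pform m n + D.pform n l := by
      simp [pform, D.skew n.1 m.1]
    have h3 : D.pform (m + n) l = D.pform m l + D.pform n l := by simp [pform]
    simp only [LinearMap.comp_apply, LinearMap.add_apply, bracketMap_X, map_smul,
      LinearMap.smul_apply, smul_smul, e1, e2, h1, h2, h3, ← add_smul]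
    congr 1
    push_cast
    ring
  have k1 : ∀ m : D.Pos, ∀ g h : D.LieAlg 𝕜,
      bracketMap D 𝕜 (X 𝕜 m) (bracketMap D 𝕜 g h) =
        bracketMap D 𝕜 (bracketMap D 𝕜 (X 𝕜 m) g) h +
          bracketMap D 𝕜 g (bracketMap D 𝕜 (X 𝕜 m) h) := by
    intro m g h
    have : (bracketMap D 𝕜).compr₂ (bracketMap D 𝕜 (X 𝕜 m)) =
        (bracketMap D 𝕜) ∘ₗ (bracketMap D 𝕜 (X 𝕜 m)) +
          (bracketMap D 𝕜).compl₂ (bracketMap D 𝕜 (X 𝕜 m)) := by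
      refine hom_ext fun n => ?_
      ext1 l
      simpa using LinearMap.congr_fun (key m n) l
    simpa using LinearMap.congr_fun (LinearMap.congr_fun this g) h
  have : (bracketMap D 𝕜).flip (bracketMap D 𝕜 g h) =
      (bracketMap D 𝕜).flip h ∘ₗ (bracketMap D 𝕜).flip g +
        (bracketMap D 𝕜 g) ∘ₗ (bracketMap D 𝕜).flip h := by
    refine hom_ext fun m => ?_
    simpa using k1 m g h
  simpa using LinearMap.congr_fun this f

noncomputable instance : LieRing (D.LieAlg 𝕜) where
  bracket f g := bracketMap D 𝕜 f g
  add_lie f g h := by simp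
  lie_add f g h := by simp
  lie_self f := by
    have h := bracketMap_skew f f
    have h2 : (2 : 𝕜) • bracketMap D 𝕜 f f = 0 := by
      rw [two_smul]
      exact add_eq_zero_iff_eq_neg.2 h
    exact (smul_eq_zero.1 h2).resolve_left two_ne_zero
  leibniz_lie f g h := bracketMap_leibniz f g h

noncomputable instance : LieAlgebra 𝕜 (D.LieAlg 𝕜) where
  lie_smul a f g := by simp [Bracket.bracket]

theorem lie_def (f g : D.LieAlg 𝕜) : ⁅f, g⁆ = bracketMap D 𝕜 f g := rfl

/-- The defining relation of `𝔤`. -/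
theorem lie_X (m n : D.Pos) : ⁅X 𝕜 m, X 𝕜 n⁆ = (D.pform m n : 𝕜) • X 𝕜 (m + n) :=
  bracketMap_X m n

end

/-! ### The quotients `𝔤_L`, the groups `G_L` and the inverse limits -/

/-- The set `𝓛` of the subsets `L ⊆ N⁺` with `N⁺ + L ⊆ L` and `#(N⁺ ∖ L) < ∞`. -/
structure Cut {N : Type*} [AddCommGroup N] (D : SkewLattice N) where
  carrier : Set D.Pos
  add_mem : ∀ m n, n ∈ carrier → m + n ∈ carrier
  finite_compl : carrierᶜ.Finite

section

variable {N : Type*} [AddCommGroup N] {D : SkewLattice N} {𝕜 : Type*} [Field 𝕜]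

instance : LE D.Cut := ⟨fun L L' => L.carrier ⊆ L'.carrier⟩

/-- `⨁_{n ∈ S} 𝕜 X_n`. -/
noncomputable def supportedOn (D : SkewLattice N) (𝕜 : Type*) [Field 𝕜] (S : Set D.Pos) :
    Submodule 𝕜 (D.LieAlg 𝕜) :=
  (Finsupp.supported 𝕜 𝕜 S : Submodule 𝕜 (D.Pos →₀ 𝕜))

theorem X_mem_supportedOn {S : Set D.Pos} {n : D.Pos} (h : n ∈ S) :
    X 𝕜 n ∈ supportedOn D 𝕜 S :=
  Finsupp.single_mem_supported 𝕜 1 h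

theorem supportedOn_le {S : Set D.Pos} {p : Submodule 𝕜 (D.LieAlg 𝕜)}
    (h : ∀ n ∈ S, X 𝕜 n ∈ p) : supportedOn D 𝕜 S ≤ p := by
  have : supportedOn D 𝕜 S = Submodule.span 𝕜 ((fun n => X 𝕜 n) '' S) :=
    Finsupp.supported_eq_span_single 𝕜 S
  rw [this, Submodule.span_le]
  rintro _ ⟨n, hn, rfl⟩
  exact h n hn

theorem supportedOn_univ : supportedOn D 𝕜 Set.univ = ⊤ := Finsupp.supported_univ

variable [CharZero 𝕜]

theorem lie_mem_supportedOn {S T U : Set D.Pos} (h : ∀ m ∈ S, ∀ n ∈ T, m + n ∈ U)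
    {f g : D.LieAlg 𝕜} (hf : f ∈ supportedOn D 𝕜 S) (hg : g ∈ supportedOn D 𝕜 T) :
    ⁅f, g⁆ ∈ supportedOn D 𝕜 U := by
  have h1 : supportedOn D 𝕜 S ≤
      (supportedOn D 𝕜 U).comap ((bracketMap D 𝕜).flip g) := by
    refine supportedOn_le fun m hm => ?_
    have h2 : supportedOn D 𝕜 T ≤ (supportedOn D 𝕜 U).comap (bracketMap D 𝕜 (X 𝕜 m)) := by
      refine supportedOn_le fun n hn => ?_
      rw [Submodule.mem_comap, bracketMap_X]
      exact Submodule.smul_mem _ _ (X_mem_supportedOn (h m hm n hn))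
    exact h2 hg
  exact h1 hf

/-- The ideal `𝔤^L = ⨁_{n ∈ L} 𝔤_n`. -/
noncomputable def Cut.ideal (𝕜 : Type*) [Field 𝕜] [CharZero 𝕜] (L : D.Cut) : LieIdeal 𝕜 (D.LieAlg 𝕜) where
  __ := supportedOn D 𝕜 L.carrier
  lie_mem {f g} hg :=
    lie_mem_supportedOn (S := Set.univ) (fun m _ n hn => L.add_mem m n hn)
      (by rw [supportedOn_univ]; trivial) hg

/-- The quotient `𝔤_L = 𝔤 / 𝔤^L`. -/
abbrev Cut.Quot (𝕜 : Type*) [Field 𝕜] [CharZero 𝕜] (L : D.Cut) : Type _ :=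
  D.LieAlg 𝕜 ⧸ L.ideal 𝕜

/-- The projection `𝔤 → 𝔤_L`. -/
noncomputable def Cut.toQuot (𝕜 : Type*) [Field 𝕜] [CharZero 𝕜] (L : D.Cut) : D.LieAlg 𝕜 →ₗ[𝕜] L.Quot 𝕜 :=
  (L.ideal 𝕜).toSubmodule.mkQ

theorem Cut.toQuot_lie (L : D.Cut) (f g : D.LieAlg 𝕜) : L.toQuot 𝕜 ⁅f, g⁆ = ⁅L.toQuot 𝕜 f, L.toQuot 𝕜 g⁆ :=
  LieSubmodule.Quotient.mk_bracket _ f g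

theorem Cut.toQuot_surjective (L : D.Cut) : Function.Surjective (L.toQuot 𝕜) :=
  Submodule.mkQ_surjective _

theorem Cut.toQuot_X (L : D.Cut) {n : D.Pos} (h : n ∈ L.carrier) : L.toQuot 𝕜 (X 𝕜 n) = 0 :=
  (Submodule.Quotient.mk_eq_zero _).2 (X_mem_supportedOn h)

instance (L : D.Cut) : LieRing.IsNilpotent (L.Quot 𝕜) := by
  have h1 : ∀ k : ℕ, ∀ x ∈ LieModule.lowerCentralSeries 𝕜 (L.Quot 𝕜) (L.Quot 𝕜) k,
      x ∈ (supportedOn D 𝕜 {n | (k : ℤ) < D.deg n}).map (L.toQuot 𝕜) := by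
    intro k
    induction k with
    | zero =>
      intro x _
      obtain ⟨f, rfl⟩ := L.toQuot_surjective x
      refine ⟨f, ?_, rfl⟩
      have : {n : D.Pos | ((0 : ℕ) : ℤ) < D.deg n} = Set.univ :=
        Set.eq_univ_of_forall fun n => by simpa using deg_pos n
      rw [this, supportedOn_univ]
      trivial
    | succ k ih =>
      intro x hx
      rw [LieModule.lowerCentralSeries_succ, ← LieSubmodule.mem_toSubmodule,
        LieSubmodule.lieIdeal_oper_eq_linear_span'] at hx
      refine (Submodule.span_le.2 ?_) hx
      rintro _ ⟨y, -, z, hz, rfl⟩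
      obtain ⟨f, rfl⟩ := L.toQuot_surjective y
      obtain ⟨g, hg, rfl⟩ := ih z hz
      refine ⟨⁅f, g⁆, ?_, L.toQuot_lie f g⟩
      refine lie_mem_supportedOn (S := Set.univ) (fun m _ n hn => ?_)
        (by rw [supportedOn_univ]; trivial) hg
      have := deg_pos m
      simp only [Set.mem_ofPred_eq, deg_add] at hn ⊢
      push_cast
      omega
  obtain ⟨K, hK⟩ : ∃ K : ℕ, ∀ n ∈ L.carrierᶜ, D.deg n ≤ K := by
    obtain ⟨B, hB⟩ := (L.finite_compl.image D.deg).bddAbove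
    exact ⟨B.toNat, fun n hn => (hB ⟨n, hn, rfl⟩).trans (Int.self_le_toNat B)⟩
  refine (LieModule.isNilpotent_iff 𝕜 (L.Quot 𝕜) (L.Quot 𝕜)).2
    ⟨K, (LieSubmodule.eq_bot_iff _).2 fun x hx => ?_⟩
  obtain ⟨f, hf, rfl⟩ := h1 K x hx
  refine (Submodule.Quotient.mk_eq_zero _).2 ?_
  refine supportedOn_le (p := (L.ideal 𝕜).toSubmodule) (fun n hn => X_mem_supportedOn ?_) hf
  by_contra h
  exact absurd (hK n h) (not_le.2 hn)

/-- The canonical homomorphism `𝔤_L → 𝔤_{L'}` for `L ⊆ L'`. -/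
noncomputable def Cut.trans (𝕜 : Type*) [Field 𝕜] [CharZero 𝕜] {L L' : D.Cut} (h : L ≤ L') :
    L.Quot 𝕜 →ₗ⁅𝕜⁆ L'.Quot 𝕜 where
  __ := Submodule.factor (p := (L.ideal 𝕜).toSubmodule) (p' := (L'.ideal 𝕜).toSubmodule)
    (Finsupp.supported_mono h)
  map_lie' {x y} := by
    obtain ⟨f, rfl⟩ := L.toQuot_surjective x
    obtain ⟨g, rfl⟩ := L.toQuot_surjective y
    rw [← L.toQuot_lie]
    exact L'.toQuot_lie f g

theorem Cut.trans_toQuot {L L' : D.Cut} (h : L ≤ L') (f : D.LieAlg 𝕜) :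
    Cut.trans 𝕜 h (L.toQuot 𝕜 f) = L'.toQuot 𝕜 f := rfl

/-- The group `G_L`. -/
abbrev Cut.Grp (𝕜 : Type*) [Field 𝕜] [CharZero 𝕜] (L : D.Cut) : Type _ :=
  ExpGroup 𝕜 (L.Quot 𝕜)

/-- The map `G_L → G_{L'}` induced by `𝔤_L → 𝔤_{L'}` for `L ⊆ L'`. -/
noncomputable def Cut.transGrp (𝕜 : Type*) [Field 𝕜] [CharZero 𝕜] {L L' : D.Cut} (h : L ≤ L')
    (g : L.Grp 𝕜) : L'.Grp 𝕜 :=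
  ExpGroup.exp (Cut.trans 𝕜 h g.log)

theorem Cut.transGrp_mul {L L' : D.Cut} (h : L ≤ L') (g₁ g₂ : L.Grp 𝕜) :
    Cut.transGrp 𝕜 h (g₁ * g₂) = Cut.transGrp 𝕜 h g₁ * Cut.transGrp 𝕜 h g₂ :=
  congrArg ExpGroup.exp (map_bch (Cut.trans 𝕜 h) g₁.log g₂.log)

end

/-- The inverse limit `𝔤^ = lim 𝔤_L`, as a subspace of `∏_L 𝔤_L`. -/
noncomputable def LieHat {N : Type*} [AddCommGroup N] (D : SkewLattice N) (𝕜 : Type*) [Field 𝕜] [CharZero 𝕜] :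
    Submodule 𝕜 (∀ L : D.Cut, L.Quot 𝕜) where
  carrier := {x | ∀ (L L' : D.Cut) (h : L ≤ L'), Cut.trans 𝕜 h (x L) = x L'}
  add_mem' hx hy L L' h := by simp [hx L L' h, hy L L' h]
  zero_mem' L L' h := by simp
  smul_mem' a x hx L L' h := by simp [hx L L' h]

/-- The inverse limit `G = lim G_L`. -/
noncomputable def G {N : Type*} [AddCommGroup N] (D : SkewLattice N) (𝕜 : Type*) [Field 𝕜] [CharZero 𝕜] :
    Type _ :=
  {g : ∀ L : D.Cut, L.Grp 𝕜 // ∀ (L L' : D.Cut) (h : L ≤ L'), Cut.transGrp 𝕜 h (g L) = g L'}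

section

variable {N : Type*} [AddCommGroup N] {D : SkewLattice N} {𝕜 : Type*} [Field 𝕜] [CharZero 𝕜]

noncomputable instance : Mul (D.G 𝕜) :=
  ⟨fun g₁ g₂ => ⟨fun L => g₁.1 L * g₂.1 L, fun L L' h => by
    rw [Cut.transGrp_mul, g₁.2 L L' h, g₂.2 L L' h]⟩⟩

noncomputable instance : One (D.G 𝕜) :=
  ⟨⟨fun _ => 1, fun _ _ h => congrArg ExpGroup.exp (map_zero (Cut.trans 𝕜 h))⟩⟩

/-- The image in `G_L` of an element of `G`. -/
noncomputable def G.proj (L : D.Cut) (g : D.G 𝕜) : L.Grp 𝕜 := g.1 L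

/-- The bijection `exp : 𝔤^ → G`, `(X_L)_L ↦ (exp_L X_L)_L`. -/
noncomputable def exp : D.LieHat 𝕜 ≃ D.G 𝕜 where
  toFun x := ⟨fun L => ExpGroup.exp (x.1 L),
    fun L L' h => congrArg ExpGroup.exp (x.2 L L' h)⟩
  invFun g := ⟨fun L => (g.1 L).log, fun L L' h => congrArg ExpGroup.log (g.2 L L' h)⟩
  left_inv _ := rfl
  right_inv _ := rfl

/-- The power `g^c = exp (c X)` of `g = exp X`, for rational `c`. -/
noncomputable instance : Pow (D.G 𝕜) ℚ := ⟨fun g c => exp ((c : 𝕜) • exp.symm g)⟩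

theorem finite_dilog (L : D.Cut) (n : D.Pos) :
    (Function.support fun j : ℕ+ =>
      L.toQuot 𝕜 (((-1 : 𝕜) ^ ((j : ℕ) + 1) / ((j : ℕ) : 𝕜) ^ 2) • X 𝕜 (Pos.mul j n))).Finite := by
  refine (L.finite_compl.preimage (Pos.mul_injective n).injOn).subset fun j hj h => hj ?_
  simp only [map_smul, Cut.toQuot_X L h, smul_zero]

/-- The element `∑_{j > 0} ((-1)^{j+1} / j²) X_{jn}` of `𝔤^`. In each `𝔤_L` all but finitely many
terms vanish. -/
noncomputable def dilogSum (𝕜 : Type*) [Field 𝕜] [CharZero 𝕜] (n : D.Pos) : D.LieHat 𝕜 :=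
  ⟨fun L => ∑ᶠ j : ℕ+,
      L.toQuot 𝕜 (((-1 : 𝕜) ^ ((j : ℕ) + 1) / ((j : ℕ) : 𝕜) ^ 2) • X 𝕜 (Pos.mul j n)),
    fun L L' h =>
      (Cut.trans 𝕜 h : L.Quot 𝕜 →ₗ[𝕜] L'.Quot 𝕜).toAddMonoidHom.map_finsum (finite_dilog L n)⟩

/-- The dilogarithm element `[n] = exp (∑_{j > 0} ((-1)^{j+1} / j²) X_{jn})` of `G`. -/
noncomputable def dilog (𝕜 : Type*) [Field 𝕜] [CharZero 𝕜] (n : D.Pos) : D.G 𝕜 :=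
  exp (dilogSum 𝕜 n)

/-- `P = ∏^→_{p ≥ 0} a_p = a₀ a₁ a₂ ⋯`: for every `L`, the image of `P` in `G_L` is that of
`a₀ a₁ ⋯ a_{l-1}` for all sufficiently large `l`. -/
def IsProdRight (a : ℕ → D.G 𝕜) (P : D.G 𝕜) : Prop :=
  ∀ L : D.Cut, ∀ᶠ l in Filter.atTop,
    G.proj L (((List.range l).map a).prod) = G.proj L P

/-- `P = ∏^←_{p ≥ 0} a_p = ⋯ a₂ a₁ a₀`: for every `L`, the image of `P` in `G_L` is that of
`a_{l-1} ⋯ a₁ a₀` for all sufficiently large `l`. -/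
def IsProdLeft (a : ℕ → D.G 𝕜) (P : D.G 𝕜) : Prop :=
  ∀ L : D.Cut, ∀ᶠ l in Filter.atTop,
    G.proj L (((List.range l).reverse.map a).prod) = G.proj L P

/-- `P = ∏_{p ≥ 0} a_p`, without regard to the order of the factors: for every `L`, the image of
`P` in `G_L` is that of the product, in any order, of the `a_p` over any sufficiently large finite
set of indices `p`. -/
def IsProdUnordered (a : ℕ → D.G 𝕜) (P : D.G 𝕜) : Prop :=
  ∀ L : D.Cut, ∃ S : Finset ℕ, ∀ l : List ℕ, l.Nodup → (∀ p ∈ S, p ∈ l) →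
    G.proj L ((l.map a).prod) = G.proj L P

end

end SkewLattice

end ClusterScattering

/-!
The group `G` is studied through the adjoint actions of the groups `G_L` on the Lie algebras `𝔤_L`.

By the Baker–Campbell–Hausdorff theorem, `exp X ↦ exp (ad X)` is multiplicative on `G_L`
(`expAd_bch`). The theorem, for the product defined by Dynkin's series, is proved by applying the
derivation `T d/dT` to `exp (T X) exp (T Y)`, which determines the logarithm of this product degree
by degree (`lie_eq_sum_bchTerm`, `exp_sum_bchTerm`). If the form is not zero, an element of `G` is
determined by its actions on all `𝔤_L`, because for every `L` there is an `L' ⊆ L` such that the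
center of `𝔤_{L'}` maps to zero in `𝔤_L` (`G.ext_act`). In particular, `G` and the `G_L` are monoids.

The element `[n]^s` acts by `X_u ↦ ∑_j binom(s {n, u}, j) X_{u + j n}` (`act_dilog_pow`). Hence the
pentagon relation `[n']^s [n]^s = [n]^s [n + n']^s [n']^s`, where `{n', n} = s⁻¹`, is an identity
between binomial coefficients (`sum_choose_pentagon`, `pentagon`).

The theorem follows from the pentagon relation in each `G_L`, where all but finitely many `[n]` are
trivial. Moving elements past each other, one first obtains the relation of type `A₁⁽¹⁾`, which
expands `[n']^{2s} [n]^{2s}`: what remains to be reordered is `[n + 2n']^s [n]^s`, a product of the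
same form in larger degree (`IsDilogSystem.affine_two_two`). In `[n']^c [n]^{4c}`, what remains to be
reordered is `[3n + 2n']^c [n]^c`, which is again of this form, with `[2n + n']^{3c}` on both sides;
moving these two powers through the expansion gives the asserted product
(`IsDilogSystem.affine_one_four`).
-/

/-! ### Power series at nilpotent elements -/

open PowerSeries in
/-- The value `∑ fₖ uᵏ` of a power series `f` at an element `u` of an associative algebra. It is
meant for nilpotent `u`: there the sum over `k < nilpotencyClass u` contains all nonzero terms. -/
noncomputable def nilEval {𝕜 R : Type*} [Field 𝕜] [Ring R] [Algebra 𝕜 R] (u : R) (f : 𝕜⟦X⟧) : R :=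
  ∑ k ∈ Finset.range (nilpotencyClass u), coeff k f • u ^ k

section NilEval

open PowerSeries

variable {𝕜 R R' : Type*} [Field 𝕜] [Ring R] [Algebra 𝕜 R] [Ring R'] [Algebra 𝕜 R']

theorem nilEval_eq_sum {u : R} {K : ℕ} (h : u ^ K = 0) (f : 𝕜⟦X⟧) :
    nilEval u f = ∑ k ∈ Finset.range K, coeff k f • u ^ k := by
  have hn : IsNilpotent u := ⟨K, h⟩
  have hle : nilpotencyClass u ≤ K := csInf_le' h
  refine Finset.sum_subset (Finset.range_mono hle) fun k _ hk => ?_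
  rw [pow_eq_zero_of_le (by simpa using hk) (pow_nilpotencyClass hn), smul_zero]

theorem nilEval_coe {u : R} (hu : IsNilpotent u) (p : Polynomial 𝕜) :
    nilEval u (p : 𝕜⟦X⟧) = Polynomial.aeval u p := by
  obtain ⟨K, hK⟩ := hu
  have h : u ^ (K + (p.natDegree + 1)) = 0 := pow_eq_zero_of_le (by omega) hK
  rw [nilEval_eq_sum h,
    Polynomial.aeval_eq_sum_range' (show p.natDegree < K + (p.natDegree + 1) by omega)]
  simp

/-- At a nilpotent element a power series may be replaced by a truncation. -/
theorem nilEval_congr {u : R} {K : ℕ} (h : u ^ K = 0) {f g : 𝕜⟦X⟧} (hfg : trunc K f = trunc K g) :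
    nilEval u f = nilEval u g := by
  rw [nilEval_eq_sum h, nilEval_eq_sum h]
  refine Finset.sum_congr rfl fun k hk => ?_
  have := congrArg (Polynomial.coeff · k) hfg
  simp only [coeff_trunc, Finset.mem_range.1 hk, if_true] at this
  rw [this]

theorem nilEval_mul {u : R} (hu : IsNilpotent u) (f g : 𝕜⟦X⟧) :
    nilEval u (f * g) = nilEval u f * nilEval u g := by
  obtain ⟨K, hK⟩ := hu
  have h1 : ∀ f : 𝕜⟦X⟧, nilEval u f = nilEval u ((trunc K f : Polynomial 𝕜) : 𝕜⟦X⟧) := fun f =>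
    nilEval_congr hK (by simp)
  rw [h1 f, h1 g, nilEval_coe ⟨K, hK⟩, nilEval_coe ⟨K, hK⟩, ← map_mul, ← nilEval_coe ⟨K, hK⟩]
  refine nilEval_congr hK ?_
  rw [Polynomial.coe_mul, trunc_trunc_mul_trunc]

theorem nilEval_add (u : R) (f g : 𝕜⟦X⟧) : nilEval u (f + g) = nilEval u f + nilEval u g := by
  simp [nilEval, add_smul, Finset.sum_add_distrib]

/-- Evaluation of power series at a nilpotent element is a homomorphism. -/
noncomputable def nilEvalHom {u : R} (hu : IsNilpotent u) : 𝕜⟦X⟧ →ₐ[𝕜] R where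
  toFun := nilEval u
  map_one' := by simpa using nilEval_coe (𝕜 := 𝕜) hu 1
  map_mul' := nilEval_mul hu
  map_zero' := by simp [nilEval]
  map_add' := nilEval_add u
  commutes' r := by simpa using nilEval_coe (𝕜 := 𝕜) hu (Polynomial.C r)

theorem nilEvalHom_apply {u : R} (hu : IsNilpotent u) (f : 𝕜⟦X⟧) :
    nilEvalHom hu f = nilEval u f := rfl

theorem nilEval_X {u : R} (hu : IsNilpotent u) : nilEval u (X : 𝕜⟦X⟧) = u := by
  simpa using nilEval_coe (𝕜 := 𝕜) hu Polynomial.X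

theorem nilEval_one {u : R} (hu : IsNilpotent u) : nilEval u (1 : 𝕜⟦X⟧) = 1 :=
  map_one (nilEvalHom hu)

theorem nilEval_sub_one {u : R} (hu : IsNilpotent u) (f : 𝕜⟦X⟧) :
    nilEval u (f - 1) = nilEval u f - 1 := by
  rw [← nilEvalHom_apply hu, map_sub, map_one, nilEvalHom_apply]

theorem nilEval_commute {u v : R} (h : Commute u v) (f g : 𝕜⟦X⟧) :
    Commute (nilEval u f) (nilEval v g) :=
  Commute.sum_left _ _ _ fun _ _ => Commute.sum_right _ _ _ fun _ _ =>
    ((h.pow_pow _ _).smul_left _).smul_right _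

theorem nilEval_commute_right {u v : R} (h : Commute u v) (g : 𝕜⟦X⟧) :
    Commute u (nilEval v g) :=
  Commute.sum_right _ _ _ fun _ _ => (h.pow_right _).smul_right _

theorem isNilpotent_nilEval {u : R} (hu : IsNilpotent u) {g : 𝕜⟦X⟧} (hg : constantCoeff g = 0) :
    IsNilpotent (nilEval u g) := by
  obtain ⟨g', rfl⟩ := X_dvd_iff.2 hg
  rw [nilEval_mul hu, nilEval_X hu]
  exact Commute.isNilpotent_mul_right (nilEval_commute_right (Commute.refl u) g') hu

/-- Evaluation is compatible with substitution: `(f ∘ g)(u) = f(g(u))`. -/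
theorem nilEval_subst {u : R} (hu : IsNilpotent u) {g : 𝕜⟦X⟧} (hg : constantCoeff g = 0)
    (f : 𝕜⟦X⟧) : nilEval u (f.subst g) = nilEval (nilEval u g) f := by
  have hs : HasSubst g := HasSubst.of_constantCoeff_zero' hg
  obtain ⟨K, hK⟩ := isNilpotent_nilEval hu hg
  have hpoly : ∀ p : Polynomial 𝕜,
      nilEval u ((p : 𝕜⟦X⟧).subst g) = nilEval (nilEval u g) (p : 𝕜⟦X⟧) := by
    intro p
    rw [subst_coe hs, nilEval_coe ⟨K, hK⟩, ← nilEvalHom_apply hu, ← Polynomial.aeval_algHom_apply]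
    rfl
  obtain ⟨h, hh⟩ : (X : 𝕜⟦X⟧) ^ K ∣ f - ((trunc K f : Polynomial 𝕜) : 𝕜⟦X⟧) := by
    rw [X_pow_dvd_iff]
    intro m hm
    simp [coeff_trunc, hm]
  have hf : f = ((trunc K f : Polynomial 𝕜) : 𝕜⟦X⟧) + X ^ K * h := by rw [← hh]; ring
  have e1 : nilEval u (f.subst g) = nilEval u (((trunc K f : Polynomial 𝕜) : 𝕜⟦X⟧).subst g) := by
    rw [congrArg (subst g) hf]
    rw [subst_add hs, subst_mul hs, subst_pow hs, subst_X hs, nilEval_add]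
    have : nilEval u (g ^ K * h.subst g) = 0 := by
      rw [nilEval_mul hu, ← nilEvalHom_apply hu, map_pow, nilEvalHom_apply, hK, zero_mul]
    rw [this, add_zero]
  rw [e1, hpoly]
  exact nilEval_congr hK (by simp)

theorem map_nilEval {u : R} (hu : IsNilpotent u) (φ : R →ₐ[𝕜] R') (f : 𝕜⟦X⟧) :
    φ (nilEval u f) = nilEval (φ u) f := by
  obtain ⟨K, hK⟩ := hu
  have h' : (φ u) ^ K = 0 := by rw [← map_pow, hK, map_zero]
  simp [nilEval_eq_sum hK, nilEval_eq_sum h', map_sum]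

theorem nilEval_smul {u : R} (hu : IsNilpotent u) (a : 𝕜) (f : 𝕜⟦X⟧) :
    nilEval (a • u) f = nilEval u (rescale a f) := by
  obtain ⟨K, hK⟩ := hu
  have h' : (a • u) ^ K = 0 := by rw [smul_pow, hK, smul_zero]
  simp [nilEval_eq_sum hK, nilEval_eq_sum h', smul_pow, smul_smul, mul_comm]

variable [CharZero 𝕜]

theorem nilEval_zero_exp : nilEval (0 : R) (exp 𝕜) = 1 := by
  rw [nilEval_eq_sum (pow_one (0 : R))]
  simp

theorem nilEval_add_smul_exp {u : R} (hu : IsNilpotent u) (a b : 𝕜) :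
    nilEval ((a + b) • u) (exp 𝕜) = nilEval (a • u) (exp 𝕜) * nilEval (b • u) (exp 𝕜) := by
  rw [nilEval_smul hu, nilEval_smul hu, nilEval_smul hu, ← nilEval_mul hu, exp_mul_exp_eq_exp_add]

theorem nilEval_neg_exp_mul {u : R} (hu : IsNilpotent u) :
    nilEval (-u) (exp 𝕜) * nilEval u (exp 𝕜) = 1 := by
  have := nilEval_add_smul_exp (𝕜 := 𝕜) hu (-1) 1
  rw [neg_add_cancel, zero_smul, nilEval_zero_exp, neg_one_smul, one_smul] at this
  exact this.symm

theorem nilEval_exp_mul_neg {u : R} (hu : IsNilpotent u) :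
    nilEval u (exp 𝕜) * nilEval (-u) (exp 𝕜) = 1 := by
  simpa using nilEval_neg_exp_mul (𝕜 := 𝕜) hu.neg

/-- A power series `F` with `(1 + X) F' = a F` and constant term `1` is the binomial series. -/
theorem coeff_eq_choose_of_derivative {F : 𝕜⟦X⟧} (a : 𝕜) (h0 : constantCoeff F = 1)
    (h : (1 + X) * d⁄dX 𝕜 F = a • F) (j : ℕ) : coeff j F = Ring.choose a j := by
  induction j with
  | zero => simpa using h0
  | succ j ih =>
    have h1 := congrArg (coeff j) h
    have h2 : coeff j ((1 + X) * d⁄dX 𝕜 F) = coeff (j + 1) F * (j + 1) + coeff j F * j := by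
      rw [add_mul, one_mul, map_add, coeff_derivative]
      cases j with
      | zero => simp
      | succ j => rw [coeff_succ_X_mul, coeff_derivative]; push_cast; ring
    rw [h2, coeff_smul, smul_eq_mul, ih] at h1
    have h3 := Ring.choose_smul_choose a (Nat.le_succ j)
    have h4 : (j + 1 : 𝕜) * Ring.choose a (j + 1) = Ring.choose a j * (a - j) := by
      simpa [Nat.choose_succ_self_right] using h3
    have h5 : (j + 1 : 𝕜) ≠ 0 := by exact_mod_cast Nat.succ_ne_zero j
    apply mul_left_cancel₀ h5
    rw [h4]
    linear_combination h1

theorem one_add_X_mul_derivative_log : (1 + X) * d⁄dX 𝕜 (log 𝕜) = 1 := by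
  rw [deriv_log]
  ext j
  cases j with
  | zero => simp
  | succ j =>
    rw [add_mul, one_mul, map_add, coeff_succ_X_mul]
    simp [coeff_one, pow_succ]

/-- `exp (a log (1 + X))` is the binomial series `(1 + X)^a`. -/
theorem coeff_exp_subst_smul_log (a : 𝕜) (j : ℕ) :
    coeff j ((exp 𝕜).subst (a • log 𝕜)) = Ring.choose a j := by
  have hs : HasSubst (a • log 𝕜) := HasSubst.of_constantCoeff_zero' (by simp)
  refine coeff_eq_choose_of_derivative a ?_ ?_ j
  · have h1 : exp 𝕜 = 1 + (exp 𝕜 - 1) := by ring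
    rw [h1, subst_add hs, map_add]
    have h2 : constantCoeff ((exp 𝕜 - 1).subst (a • log 𝕜)) = 0 :=
      constantCoeff_subst_eq_zero
      (show constantCoeff (a • log 𝕜) = 0 by simp) _ (by simp)
    rw [h2, ← coe_substAlgHom hs, map_one]
    simp
  · rw [derivative_subst hs, derivative_exp, (d⁄dX 𝕜).map_smul]
    simp only [smul_eq_C_mul]
    linear_combination (C a * (exp 𝕜).subst (C a * log 𝕜)) * one_add_X_mul_derivative_log (𝕜 := 𝕜)

theorem exp_subst_log : (exp 𝕜).subst (log 𝕜) = 1 + X := by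
  ext j
  have h := coeff_exp_subst_smul_log (1 : 𝕜) j
  rw [one_smul] at h
  rw [h]
  rcases j with _ | _ | j
  · simp
  · simp
  · have := Ring.choose_natCast (R := 𝕜) 1 (j + 2)
    rw [Nat.cast_one] at this
    rw [this]
    simp [coeff_one, coeff_X, Nat.choose_eq_zero_of_lt]

theorem log_subst_exp_sub_one : (log 𝕜).subst (exp 𝕜 - 1) = X := by
  have hs : HasSubst (exp 𝕜 - 1) := HasSubst.exp_sub_one
  have hc : constantCoeff ((log 𝕜).subst (exp 𝕜 - 1)) = 0 :=
    constantCoeff_subst_eq_zero (show constantCoeff (exp 𝕜 - 1) = 0 by simp) _ (by simp)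
  refine derivative.ext ?_ (by rw [hc]; simp)
  rw [derivative_subst hs]
  have h := congrArg (subst (exp 𝕜 - 1)) (one_add_X_mul_derivative_log (𝕜 := 𝕜))
  rw [subst_mul hs, subst_add hs, subst_X hs, ← coe_substAlgHom hs, map_one] at h
  rw [coe_substAlgHom] at h
  simp only [map_sub, derivative_exp, derivative_X]
  have : d⁄dX 𝕜 (1 : 𝕜⟦X⟧) = 0 := by simp
  rw [this, sub_zero]
  linear_combination h

/-- `log (exp u) = u`. -/
theorem nilEval_log_exp {u : R} (hu : IsNilpotent u) :
    nilEval (nilEval u (exp 𝕜) - 1) (log 𝕜) = u := by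
  rw [← nilEval_sub_one hu, ← nilEval_subst hu (by simp), log_subst_exp_sub_one, nilEval_X hu]

/-- `exp (log (1 + u)) = 1 + u`. -/
theorem nilEval_exp_log {u : R} (hu : IsNilpotent u) :
    nilEval (nilEval u (log 𝕜)) (exp 𝕜) = 1 + u := by
  rw [← nilEval_subst hu (by simp), exp_subst_log, nilEval_add, nilEval_one hu, nilEval_X hu]

theorem nilEval_exp_injective {u v : R} (hu : IsNilpotent u) (hv : IsNilpotent v)
    (h : nilEval u (exp 𝕜) = nilEval v (exp 𝕜)) : u = v := by
  rw [← nilEval_log_exp (𝕜 := 𝕜) hu, h, nilEval_log_exp hv]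

end NilEval

/-! ### Conjugation by exponentials and Dynkin words -/

section ExpConj

open PowerSeries LieAlgebra

attribute [local instance] LieRing.ofAssociativeRing

variable {𝕜 R : Type*} [Field 𝕜] [CharZero 𝕜] [Ring R] [Algebra 𝕜 R]

theorem nilEval_exp_add {u v : R} (h : Commute u v) (hu : IsNilpotent u) (hv : IsNilpotent v) :
    nilEval (u + v) (exp 𝕜) = nilEval u (exp 𝕜) * nilEval v (exp 𝕜) := by
  -- Mathlib's `IsNilpotent.exp` takes its coefficients in `ℚ`.
  let _ : Module ℚ R := Module.compHom R (algebraMap ℚ 𝕜)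
  have key : ∀ w : R, IsNilpotent w → nilEval w (exp 𝕜) = IsNilpotent.exp w := by
    rintro w ⟨K, hK⟩
    rw [nilEval_eq_sum hK, IsNilpotent.exp_eq_sum hK]
    refine Finset.sum_congr rfl fun k _ => ?_
    rw [coeff_exp, one_div]
    rfl
  rw [key _ hu, key _ hv, key _ (h.isNilpotent_add hu hv), IsNilpotent.exp_add_of_commute h hu hv]

/-- `exp (ad z) w = exp z * w * exp (-z)`. -/
theorem nilEval_ad_exp {z : R} (hz : IsNilpotent z) (w : R) :
    nilEval (ad 𝕜 R z) (exp 𝕜) w = nilEval z (exp 𝕜) * w * nilEval (-z) (exp 𝕜) := by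
  have hl : IsNilpotent (LinearMap.mulLeft 𝕜 z) := by
    obtain ⟨K, hK⟩ := hz
    exact ⟨K, by rw [LinearMap.pow_mulLeft, hK, LinearMap.mulLeft_zero_eq_zero]⟩
  have hr : IsNilpotent (LinearMap.mulRight 𝕜 (-z)) := by
    obtain ⟨K, hK⟩ := hz.neg
    exact ⟨K, by rw [LinearMap.pow_mulRight, hK, LinearMap.mulRight_zero_eq_zero]⟩
  have h1 : (ad 𝕜 R z : Module.End 𝕜 R) = LinearMap.mulLeft 𝕜 z + LinearMap.mulRight 𝕜 (-z) := by
    ext w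
    simp [Ring.lie_def, sub_eq_add_neg]
  have h2 : ∀ f : 𝕜⟦X⟧, nilEval (LinearMap.mulLeft 𝕜 z) f = LinearMap.mulLeft 𝕜 (nilEval z f) := by
    intro f
    obtain ⟨K, hK⟩ := hz
    have h' : (LinearMap.mulLeft 𝕜 z) ^ K = 0 := by
      rw [LinearMap.pow_mulLeft, hK, LinearMap.mulLeft_zero_eq_zero]
    ext w
    simp [nilEval_eq_sum hK, nilEval_eq_sum h', LinearMap.pow_mulLeft, Finset.sum_mul]
  have h3 : ∀ f : 𝕜⟦X⟧,
      nilEval (LinearMap.mulRight 𝕜 (-z)) f = LinearMap.mulRight 𝕜 (nilEval (-z) f) := by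
    intro f
    obtain ⟨K, hK⟩ := hz.neg
    have h' : (LinearMap.mulRight 𝕜 (-z)) ^ K = 0 := by
      rw [LinearMap.pow_mulRight, hK, LinearMap.mulRight_zero_eq_zero]
    ext w
    simp [nilEval_eq_sum hK, nilEval_eq_sum h', LinearMap.pow_mulRight, Finset.mul_sum]
  -- `ad z` is the sum of the commuting left and right multiplications by `z` and `-z`.
  rw [h1, nilEval_exp_add (LinearMap.commute_mulLeft_right z (-z)) hl hr, h2, h3]
  simp [mul_assoc]

/-- If `exp z = exp x exp y`, then `exp (ad z) = exp (ad x) exp (ad y)`. -/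
theorem nilEval_ad_exp_mul {x y z : R} (hx : IsNilpotent x) (hy : IsNilpotent y)
    (hz : IsNilpotent z) (h : nilEval z (exp 𝕜) = nilEval x (exp 𝕜) * nilEval y (exp 𝕜)) :
    nilEval (ad 𝕜 R z) (exp 𝕜) = nilEval (ad 𝕜 R x) (exp 𝕜) * nilEval (ad 𝕜 R y) (exp 𝕜) := by
  have hi : nilEval (-z) (exp 𝕜) = nilEval (-y) (exp 𝕜) * nilEval (-x) (exp 𝕜) := by
    refine left_inv_eq_right_inv (nilEval_neg_exp_mul hz) ?_
    rw [h, mul_assoc, ← mul_assoc (nilEval y _), nilEval_exp_mul_neg hy, one_mul,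
      nilEval_exp_mul_neg hx]
  refine LinearMap.ext fun w => ?_
  simp only [Module.End.mul_apply, nilEval_ad_exp hx, nilEval_ad_exp hy, nilEval_ad_exp hz, h, hi,
    mul_assoc]

end ExpConj

section Dynkin

open ClusterScattering PowerSeries LieAlgebra

variable {𝕜 : Type*} [Field 𝕜]

theorem nestedBracket_cons {𝔫 : Type*} [LieRing 𝔫] (x : 𝔫) {l : List 𝔫} (h : l ≠ []) :
    nestedBracket (x :: l) = ⁅x, nestedBracket l⁆ := by
  cases l with
  | nil => exact absurd rfl h
  | cons y l => rfl

theorem nestedBracket_replicate_append {𝔫 : Type*} [LieRing 𝔫] [LieAlgebra 𝕜 𝔫] (r : ℕ) (x : 𝔫)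
    {l : List 𝔫} (h : l ≠ []) :
    nestedBracket (List.replicate r x ++ l) = ((ad 𝕜 𝔫 x) ^ r) (nestedBracket l) := by
  induction r with
  | zero => simp
  | succ r ih =>
    rw [List.replicate_succ, List.cons_append, nestedBracket_cons _ (by simp [h]), ih, pow_succ',
      Module.End.mul_apply, ad_apply]

theorem dynkinWord_cons {𝔫 : Type*} {k : ℕ} (p : ℕ × ℕ) (e : Fin k → ℕ × ℕ) (x y : 𝔫) :
    dynkinWord (Fin.cons p e) x y =
      List.replicate p.1 x ++ (List.replicate p.2 y ++ dynkinWord e x y) := by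
  simp [dynkinWord, List.ofFn_succ]

/-- The coefficient `1 / (r! s!)`. -/
noncomputable def expCoeff (𝕜 : Type*) [Field 𝕜] (p : ℕ × ℕ) : 𝕜 :=
  ((p.1.factorial : 𝕜) * (p.2.factorial : 𝕜))⁻¹

/-- The pairs of exponents `(r, s) ≠ (0, 0)` with `r, s < B`. -/
def expBox (B : ℕ) : Finset (ℕ × ℕ) :=
  (Finset.range B ×ˢ Finset.range B).filter fun p => 0 < p.1 + p.2

variable [CharZero 𝕜]

theorem coeff_exp_eq (r : ℕ) : coeff r (PowerSeries.exp 𝕜) = ((r.factorial : 𝕜))⁻¹ := by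
  simp [coeff_exp]

theorem sum_range_product_eq {M : Type*} [AddCommMonoid M] {B : ℕ} (hB : 0 < B) (f : ℕ × ℕ → M) :
    ∑ p ∈ Finset.range B ×ˢ Finset.range B, f p = f (0, 0) + ∑ p ∈ expBox B, f p := by
  have : Finset.range B ×ˢ Finset.range B = insert (0, 0) (expBox B) := by
    ext ⟨r, s⟩
    simp only [expBox, Finset.mem_product, Finset.mem_range, Finset.mem_insert, Finset.mem_filter,
      Prod.mk.injEq]
    omega
  rw [this, Finset.sum_insert (by simp [expBox])]

theorem exp_ad_mul_exp_ad_sub_one {𝔫 : Type*} [LieRing 𝔫] [LieAlgebra 𝕜 𝔫] {x y : 𝔫} {B : ℕ}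
    (hB : 0 < B) (hx : (ad 𝕜 𝔫 x) ^ B = 0) (hy : (ad 𝕜 𝔫 y) ^ B = 0) :
    nilEval (ad 𝕜 𝔫 x) (PowerSeries.exp 𝕜) * nilEval (ad 𝕜 𝔫 y) (PowerSeries.exp 𝕜) - 1 =
      ∑ p ∈ expBox B, expCoeff 𝕜 p • ((ad 𝕜 𝔫 x) ^ p.1 * (ad 𝕜 𝔫 y) ^ p.2) := by
  have := sum_range_product_eq hB fun p =>
    expCoeff 𝕜 p • (((ad 𝕜 𝔫 x) ^ p.1 * (ad 𝕜 𝔫 y) ^ p.2 : Module.End 𝕜 𝔫))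
  rw [nilEval_eq_sum hx, nilEval_eq_sum hy, Finset.sum_mul_sum, ← Finset.sum_product']
  rw [sub_eq_iff_eq_add, add_comm]
  refine (Finset.sum_congr rfl fun p _ => ?_).trans (this.trans ?_)
  · simp only [coeff_exp_eq, expCoeff, smul_mul_smul_comm, mul_inv]
  · simp [expCoeff]

theorem nestedBracket_replicate_of_two_le {𝔫 : Type*} [LieRing 𝔫] (x : 𝔫) (s : ℕ) :
    nestedBracket (List.replicate (s + 2) x) = 0 := by
  induction s with
  | zero => simp [List.replicate, nestedBracket]
  | succ s ih => rw [List.replicate_succ, nestedBracket_cons _ (by simp), ih, lie_zero]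

/-- The last block of a Dynkin word contributes only if it is `X` or `X^r Y`. -/
theorem add_exp_ad_apply {𝔫 : Type*} [LieRing 𝔫] [LieAlgebra 𝕜 𝔫] {x y : 𝔫} {B : ℕ}
    (hB : 1 < B) (hx : (ad 𝕜 𝔫 x) ^ B = 0) :
    x + nilEval (ad 𝕜 𝔫 x) (PowerSeries.exp 𝕜) y =
      ∑ p ∈ expBox B, expCoeff 𝕜 p •
        nestedBracket (List.replicate p.1 x ++ (List.replicate p.2 y ++ [])) := by
  have h0 := sum_range_product_eq (by omega : 0 < B) fun p : ℕ × ℕ => expCoeff 𝕜 p •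
        nestedBracket (List.replicate p.1 x ++ (List.replicate p.2 y ++ []))
  have h00 : expCoeff 𝕜 (0, 0) •
      nestedBracket (List.replicate (0, 0).1 x ++ (List.replicate (0, 0).2 y ++ [])) = 0 := by
    simp [nestedBracket]
  rw [h00, zero_add] at h0
  rw [← h0, Finset.sum_product_right]
  obtain ⟨B, rfl⟩ : ∃ b, B = b + 2 := ⟨B - 2, by omega⟩
  rw [Finset.sum_range_succ', Finset.sum_range_succ']
  have e1 : ∀ s : ℕ, ∑ r ∈ Finset.range (B + 2), expCoeff 𝕜 (r, s + 1 + 1) •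
      nestedBracket (List.replicate r x ++ (List.replicate (s + 1 + 1) y ++ [])) = 0 := by
    intro s
    refine Finset.sum_eq_zero fun r _ => ?_
    rw [nestedBracket_replicate_append (𝕜 := 𝕜) r x (by simp), List.append_nil,
      nestedBracket_replicate_of_two_le, map_zero, smul_zero]
  have e2 : ∑ r ∈ Finset.range (B + 2), expCoeff 𝕜 (r, 0 + 1) •
      nestedBracket (List.replicate r x ++ (List.replicate (0 + 1) y ++ [])) =
      nilEval (ad 𝕜 𝔫 x) (PowerSeries.exp 𝕜) y := by
    rw [nilEval_eq_sum hx, LinearMap.sum_apply]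
    refine Finset.sum_congr rfl fun r _ => ?_
    rw [nestedBracket_replicate_append (𝕜 := 𝕜) r x (by simp)]
    simp [expCoeff, nestedBracket]
  have e3 : ∑ r ∈ Finset.range (B + 2), expCoeff 𝕜 (r, 0) •
      nestedBracket (List.replicate r x ++ (List.replicate 0 y ++ [])) = x := by
    rw [Finset.sum_range_succ', Finset.sum_range_succ', Finset.sum_eq_zero]
    · simp [expCoeff, nestedBracket]
    · intro r _
      simp only [List.replicate_zero, List.append_nil]
      rw [nestedBracket_replicate_of_two_le, smul_zero]
  simp only [e1, e2, e3, Finset.sum_const_zero, zero_add]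
  exact add_comm _ _

theorem sum_piFinset_succ {M α : Type*} [AddCommMonoid M] (s : Finset α) (k : ℕ)
    (f : (Fin (k + 1) → α) → M) :
    ∑ e ∈ Fintype.piFinset (fun _ : Fin (k + 1) => s), f e =
      ∑ p ∈ s, ∑ e ∈ Fintype.piFinset (fun _ : Fin k => s), f (Fin.cons p e) := by
  rw [← Finset.sum_product']
  refine Finset.sum_bij' (fun e _ => (e 0, Fin.tail e)) (fun q _ => Fin.cons q.1 q.2) ?_ ?_ ?_ ?_ ?_
  · intro e he
    simp only [Fintype.mem_piFinset, Finset.mem_product] at he ⊢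
    exact ⟨he 0, fun i => he i.succ⟩
  · intro q hq
    simp only [Fintype.mem_piFinset, Finset.mem_product] at hq ⊢
    exact Fin.cases hq.1 hq.2
  · intro e _
    simp
  · intro q _
    simp
  · intro e _
    simp

/-- The expansion of `(exp (ad x) exp (ad y) - 1)^k (x + exp (ad x) y)` into Dynkin words with `k + 1`
blocks: each factor contributes one block in front, and the vector contributes the last block. -/
theorem exp_ad_sub_one_pow_apply {𝔫 : Type*} [LieRing 𝔫] [LieAlgebra 𝕜 𝔫] {x y : 𝔫} {B : ℕ}
    (hB : 1 < B) (hx : (ad 𝕜 𝔫 x) ^ B = 0) (hy : (ad 𝕜 𝔫 y) ^ B = 0) (k : ℕ) :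
    ((nilEval (ad 𝕜 𝔫 x) (PowerSeries.exp 𝕜) * nilEval (ad 𝕜 𝔫 y) (PowerSeries.exp 𝕜) - 1) ^ k)
        (x + nilEval (ad 𝕜 𝔫 x) (PowerSeries.exp 𝕜) y) =
      ∑ e ∈ Fintype.piFinset (fun _ : Fin (k + 1) => expBox B),
        (∏ i, expCoeff 𝕜 (e i)) • nestedBracket (dynkinWord e x y) := by
  induction k with
  | zero =>
    rw [sum_piFinset_succ, pow_zero, Module.End.one_apply, add_exp_ad_apply hB hx]
    refine Finset.sum_congr rfl fun p _ => ?_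
    simp [dynkinWord]
  | succ k ih =>
    rw [sum_piFinset_succ, pow_succ', Module.End.mul_apply, ih,
      exp_ad_mul_exp_ad_sub_one (by omega) hx hy, LinearMap.sum_apply]
    refine Finset.sum_congr rfl fun p _ => ?_
    rw [map_sum]
    refine Finset.sum_congr rfl fun e he => ?_
    have hne : dynkinWord e x y ≠ [] := by
      have h0 := (Finset.mem_filter.1 (Fintype.mem_piFinset.1 he 0)).2
      intro h
      rw [← Fin.cons_self_tail e, dynkinWord_cons] at h
      simp at h
      omega
    rw [dynkinWord_cons, nestedBracket_replicate_append (𝕜 := 𝕜) _ _ (by simp [hne]),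
      nestedBracket_replicate_append (𝕜 := 𝕜) _ _ hne,
      Fin.prod_univ_succ fun i => expCoeff 𝕜 ((Fin.cons p e : Fin (k + 2) → ℕ × ℕ) i)]
    simp only [Fin.cons_zero, Fin.cons_succ, LinearMap.smul_apply, Module.End.mul_apply, map_smul,
      mul_smul]
    rw [smul_comm]

end Dynkin

/-! ### A differential equation for the logarithm of a product of exponentials -/

section BCHDerivation

open ClusterScattering PowerSeries LieAlgebra

attribute [local instance] LieRing.ofAssociativeRing

variable {𝕜 Ω : Type*} [Field 𝕜] [Ring Ω] [Algebra 𝕜 Ω]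

theorem nestedBracket_mem_pow {J : Submodule 𝕜 Ω} :
    ∀ l : List Ω, (∀ a ∈ l, a ∈ J) → l ≠ [] → nestedBracket l ∈ J ^ l.length
  | [], _, h => absurd rfl h
  | [a], h, _ => by simpa [nestedBracket] using h
  | a :: b :: l, h, _ => by
      have h1 := nestedBracket_mem_pow (b :: l) (fun c hc => h c (List.mem_cons_of_mem _ hc))
        (by simp)
      have h2 : a ∈ J := h a (by simp)
      rw [nestedBracket, Ring.lie_def, List.length_cons]
      refine Submodule.sub_mem _ ?_ ?_
      · rw [pow_succ']
        exact Submodule.mul_mem_mul h2 h1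
      · rw [pow_succ]
        exact Submodule.mul_mem_mul h1 h2

theorem mem_of_mem_dynkinWord {𝔫 : Type*} {k : ℕ} {e : Fin k → ℕ × ℕ} {x y a : 𝔫}
    (h : a ∈ dynkinWord e x y) : a = x ∨ a = y := by
  simp only [dynkinWord, List.mem_flatten, List.mem_ofFn] at h
  obtain ⟨l, ⟨i, rfl⟩, h⟩ := h
  rcases List.mem_append.1 h with h | h
  · exact Or.inl (List.eq_of_mem_replicate h)
  · exact Or.inr (List.eq_of_mem_replicate h)

theorem length_dynkinWord_eq {𝔫 : Type*} {k : ℕ} (e : Fin k → ℕ × ℕ) (x y : 𝔫) :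
    (dynkinWord e x y).length = ∑ i, ((e i).1 + (e i).2) := by
  simp [dynkinWord, List.length_flatten, List.map_ofFn, List.sum_ofFn, Function.comp_def]

theorem pow_eq_bot_of_le {J : Submodule 𝕜 Ω} {M n : ℕ} (hJ : J ^ M = ⊥) (h : M ≤ n) :
    J ^ n = ⊥ := by
  obtain ⟨d, rfl⟩ := Nat.exists_eq_add_of_le h
  rw [pow_add, hJ, Submodule.bot_mul]

theorem nestedBracket_dynkinWord_eq_zero {J : Submodule 𝕜 Ω} {M : ℕ} (hJ : J ^ M = ⊥) {x y : Ω}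
    (hx : x ∈ J) (hy : y ∈ J) {k : ℕ} (e : Fin k → ℕ × ℕ) (h : M ≤ ∑ i, ((e i).1 + (e i).2)) :
    nestedBracket (dynkinWord e x y) = 0 := by
  by_cases hne : dynkinWord e x y = []
  · rw [hne, nestedBracket]
  · have h1 := nestedBracket_mem_pow (J := J) (dynkinWord e x y)
      (fun a ha => by rcases mem_of_mem_dynkinWord ha with rfl | rfl <;> assumption) hne
    rw [length_dynkinWord_eq, pow_eq_bot_of_le hJ h] at h1
    exact h1

theorem bchTerm_eq_zero_of_pow_eq_bot {J : Submodule 𝕜 Ω} {M m : ℕ} (hJ : J ^ M = ⊥) {x y : Ω}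
    (hx : x ∈ J) (hy : y ∈ J) (h : M ≤ m) : bchTerm 𝕜 m x y = 0 := by
  refine Finset.sum_eq_zero fun k _ => Finset.sum_eq_zero fun e he => ?_
  rw [nestedBracket_dynkinWord_eq_zero hJ hx hy e, smul_zero]
  rw [(Finset.mem_filter.1 he).2.2]
  exact h

/-- Sorting the sequences of blocks by their total degree. -/
theorem sum_piFinset_expBox {N : Type*} [AddCommMonoid N] {B M : ℕ} (hMB : M ≤ B) (k : ℕ)
    (f : (Fin k → ℕ × ℕ) → N) (hf : ∀ e, M ≤ ∑ i, ((e i).1 + (e i).2) → f e = 0) :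
    ∑ e ∈ Fintype.piFinset (fun _ : Fin k => expBox B), f e =
      ∑ m ∈ Finset.range M, ∑ e ∈ dynkinIndex k m, f e := by
  classical
  rw [← Finset.sum_filter_add_sum_filter_not _ (fun e => ∑ i, ((e i).1 + (e i).2) < M)]
  rw [Finset.sum_eq_zero (s := Finset.filter (fun e => ¬ ∑ i, ((e i).1 + (e i).2) < M) _)
    (fun e he => hf e (not_lt.1 (Finset.mem_filter.1 he).2)), add_zero]
  rw [← Finset.sum_fiberwise_of_maps_to (t := Finset.range M)
    (g := fun e => ∑ i, ((e i).1 + (e i).2)) (by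
      intro e he
      simpa using (Finset.mem_filter.1 he).2)]
  refine Finset.sum_congr rfl fun m hm => Finset.sum_congr ?_ fun _ _ => rfl
  have hm' := Finset.mem_range.1 hm
  ext e
  simp only [Finset.mem_filter, Fintype.mem_piFinset, expBox, dynkinIndex, Finset.mem_product,
    Finset.mem_range]
  constructor
  · rintro ⟨⟨h1, h2⟩, rfl⟩
    refine ⟨fun i => ?_, fun i => (h1 i).2, rfl⟩
    have := Finset.single_le_sum (f := fun i => (e i).1 + (e i).2) (fun _ _ => Nat.zero_le _)
      (Finset.mem_univ i)
    omega
  · rintro ⟨h1, h2, rfl⟩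
    refine ⟨⟨fun i => ⟨?_, h2 i⟩, hm'⟩, rfl⟩
    have := h1 i
    omega

variable [CharZero 𝕜]

/-- If `exp z = exp x exp y` and `x`, `y` have weight `1` for the derivation `[δ, ·]`, then
`[δ, z]` is the weighted sum `∑ m • bchTerm m x y`. The reason is that `ad z` applied to `δ` is
`log (exp (ad x) exp (ad y)) δ`, where `(exp (ad x) exp (ad y) - 1) δ = -(x + exp (ad x) y)`. -/
theorem lie_eq_sum_bchTerm {J : Submodule 𝕜 Ω} {M : ℕ} (hJ : J ^ M = ⊥) {x y z δ : Ω}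
    (hx : x ∈ J) (hy : y ∈ J) (hz : IsNilpotent z)
    (h : nilEval z (PowerSeries.exp 𝕜) =
      nilEval x (PowerSeries.exp 𝕜) * nilEval y (PowerSeries.exp 𝕜))
    (hδx : ⁅δ, x⁆ = x) (hδy : ⁅δ, y⁆ = y) :
    ⁅δ, z⁆ = ∑ m ∈ Finset.range M, (m : 𝕜) • bchTerm 𝕜 m x y := by
  have hpow : ∀ a ∈ J, IsNilpotent a := fun a ha => ⟨M, by
    have := Submodule.pow_mem_pow J ha M
    rwa [hJ] at this⟩
  have nx := ad_nilpotent_of_nilpotent (R := 𝕜) (hpow x hx)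
  have ny := ad_nilpotent_of_nilpotent (R := 𝕜) (hpow y hy)
  have nz := ad_nilpotent_of_nilpotent (R := 𝕜) hz
  have hF := nilEval_ad_exp_mul (𝕜 := 𝕜) (hpow x hx) (hpow y hy) hz h
  obtain ⟨B, hMB, hB1, hBx, hBy⟩ : ∃ B, M ≤ B ∧ 1 < B ∧
      (ad 𝕜 Ω x) ^ B = 0 ∧ (ad 𝕜 Ω y) ^ B = 0 := by
    obtain ⟨a, ha⟩ := nx
    obtain ⟨b, hb⟩ := ny
    exact ⟨M + 2 + a + b, by omega, by omega, pow_eq_zero_of_le (by omega) ha,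
      pow_eq_zero_of_le (by omega) hb⟩
  have hU : IsNilpotent (nilEval (ad 𝕜 Ω z) (PowerSeries.exp 𝕜) - 1) := by
    rw [← nilEval_sub_one nz]
    exact isNilpotent_nilEval nz (by simp)
  obtain ⟨K, hMK, hK⟩ : ∃ K, M ≤ K ∧
      (nilEval (ad 𝕜 Ω z) (PowerSeries.exp 𝕜) - 1) ^ (K + 1) = 0 := by
    obtain ⟨a, ha⟩ := hU
    exact ⟨M + a, by omega, pow_eq_zero_of_le (by omega) ha⟩
  -- `(ad w) δ = -w` and `(ad w)² δ = 0` for `w = x, y`, so their exponential series break off.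
  have hFδ : (nilEval (ad 𝕜 Ω z) (PowerSeries.exp 𝕜) - 1) δ =
      -(x + nilEval (ad 𝕜 Ω x) (PowerSeries.exp 𝕜) y) := by
    have e1 : ∀ w ∈ J, ⁅δ, w⁆ = w → nilEval (ad 𝕜 Ω w) (PowerSeries.exp 𝕜) δ = δ - w := by
      intro w hw hδw
      obtain ⟨a, ha⟩ := ad_nilpotent_of_nilpotent (R := 𝕜) (hpow w hw)
      have h1 : ⁅w, δ⁆ = -w := by rw [← lie_skew, hδw]
      have h2 : (ad 𝕜 Ω w) ^ (a + 2) = 0 := pow_eq_zero_of_le (by omega) ha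
      rw [nilEval_eq_sum h2, Finset.sum_range_succ', Finset.sum_range_succ', LinearMap.add_apply,
        LinearMap.add_apply, LinearMap.sum_apply, Finset.sum_eq_zero]
      · simp [h1, sub_eq_neg_add]
      · intro k _
        rw [LinearMap.smul_apply, pow_succ, pow_succ, Module.End.mul_apply, Module.End.mul_apply,
          ad_apply, ad_apply, h1, lie_neg, lie_self, neg_zero, map_zero, smul_zero]
    rw [hF, LinearMap.sub_apply, Module.End.mul_apply, e1 y hy hδy, map_sub, e1 x hx hδx,
      Module.End.one_apply]
    abel
  have hlog := nilEval_log_exp (𝕜 := 𝕜) nz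
  have h1 : ⁅z, δ⁆ =
      nilEval (nilEval (ad 𝕜 Ω z) (PowerSeries.exp 𝕜) - 1) (PowerSeries.log 𝕜) δ := by
    rw [hlog, ad_apply]
  rw [nilEval_eq_sum hK, Finset.sum_range_succ', LinearMap.add_apply, LinearMap.sum_apply] at h1
  have h2 : ⁅δ, z⁆ = ∑ k ∈ Finset.range K, ((-1 : 𝕜) ^ (k + 2) / ((k + 1 : ℕ) : 𝕜)) •
      ∑ m ∈ Finset.range M, ∑ e ∈ dynkinIndex (k + 1) m,
        (∏ i, expCoeff 𝕜 (e i)) • nestedBracket (dynkinWord e x y) := by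
    rw [← lie_skew, h1]
    have h0 : coeff 0 (PowerSeries.log 𝕜) = 0 := by simp
    rw [h0, zero_smul, LinearMap.zero_apply, add_zero, ← Finset.sum_neg_distrib]
    refine Finset.sum_congr rfl fun k _ => ?_
    rw [LinearMap.smul_apply, pow_succ, Module.End.mul_apply, hFδ, map_neg, smul_neg, neg_neg, hF,
      exp_ad_sub_one_pow_apply hB1 hBx hBy, sum_piFinset_expBox hMB]
    · congr 1
      rw [coeff_log]
      simp [pow_succ]
    · intro e he
      rw [nestedBracket_dynkinWord_eq_zero hJ hx hy e he, smul_zero]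
  -- A term with more blocks than its degree does not occur, so the range of `k` may be changed.
  rw [h2]
  simp only [Finset.smul_sum]
  rw [Finset.sum_comm]
  refine Finset.sum_congr rfl fun m hm => ?_
  have hm' := Finset.mem_range.1 hm
  rw [bchTerm, Finset.smul_sum, Finset.range_eq_Ico, Finset.sum_Ico_add' (fun k =>
    ∑ e ∈ dynkinIndex k m, ((-1 : 𝕜) ^ (k + 1) / ((k : ℕ) : 𝕜)) •
        (∏ i, expCoeff 𝕜 (e i)) • nestedBracket (dynkinWord e x y)) 0 K 1]
  symm
  refine Finset.sum_subset_zero_on_sdiff ?_ ?_ ?_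
  · intro k hk
    rw [Finset.mem_Icc] at hk
    rw [Finset.mem_Ico]
    omega
  · intro k hk
    refine Finset.sum_eq_zero fun e he => ?_
    exfalso
    simp only [Finset.mem_sdiff, Finset.mem_Ico, Finset.mem_Icc, not_and, not_le] at hk
    have h3 := (Finset.mem_filter.1 he).2
    have h4 : ∑ _i : Fin k, 1 ≤ m := h3.2 ▸ Finset.sum_le_sum fun i _ => h3.1 i
    simp at h4
    omega
  · intro k hk
    rw [Finset.smul_sum]
    refine Finset.sum_congr rfl fun e _ => ?_
    rw [smul_smul, smul_smul]
    congr 1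
    rw [Finset.mem_Icc] at hk
    have hk0 : (k : 𝕜) ≠ 0 := by exact_mod_cast (by omega : k ≠ 0)
    have hm0 : (m : 𝕜) ≠ 0 := by exact_mod_cast (by omega : m ≠ 0)
    simp only [expCoeff, Finset.prod_inv_distrib]
    field_simp

end BCHDerivation

/-! ### The Baker–Campbell–Hausdorff formula for nilpotent elements -/

section BCHTheorem

open ClusterScattering LieAlgebra Polynomial

attribute [local instance] LieRing.ofAssociativeRing

variable {𝕜 A : Type*} [Field 𝕜] [Ring A] [Algebra 𝕜 A]

/-- The polynomials with coefficients in a subspace `I`. -/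
noncomputable def polySubmodule (I : Submodule 𝕜 A) : Submodule 𝕜 A[X] where
  carrier := {p | ∀ i, p.coeff i ∈ I}
  add_mem' hp hq i := by rw [coeff_add]; exact I.add_mem (hp i) (hq i)
  zero_mem' i := by rw [coeff_zero]; exact I.zero_mem
  smul_mem' a p hp i := by rw [coeff_smul]; exact I.smul_mem a (hp i)

theorem polySubmodule_mul_le (I I' : Submodule 𝕜 A) :
    polySubmodule I * polySubmodule I' ≤ polySubmodule (I * I') := by
  refine Submodule.mul_le.2 fun p hp q hq i => ?_
  rw [coeff_mul]
  exact Submodule.sum_mem _ fun c _ => Submodule.mul_mem_mul (hp _) (hq _)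

theorem polySubmodule_pow_le (I : Submodule 𝕜 A) (k : ℕ) :
    polySubmodule I ^ (k + 1) ≤ polySubmodule (I ^ (k + 1)) := by
  induction k with
  | zero => simp
  | succ k ih =>
    rw [pow_succ, pow_succ (n := k + 1)]
    exact (mul_le_mul_left ih _).trans (polySubmodule_mul_le _ _)

theorem polySubmodule_mono {I I' : Submodule 𝕜 A} (h : I ≤ I') :
    polySubmodule I ≤ polySubmodule I' := fun _ hp i => h (hp i)

theorem polySubmodule_pow_eq_bot {I : Submodule 𝕜 A} {M : ℕ} (hM : I ^ M = ⊥) (hM0 : 0 < M) :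
    polySubmodule I ^ M = ⊥ := by
  obtain ⟨k, rfl⟩ : ∃ k, M = k + 1 := ⟨M - 1, by omega⟩
  refine (Submodule.eq_bot_iff _).2 fun p hp => Polynomial.ext fun i => ?_
  have h1 := polySubmodule_pow_le I k hp i
  rw [hM] at h1
  simpa using h1

theorem isNilpotent_of_mem {R : Type*} [Ring R] [Algebra 𝕜 R] {J : Submodule 𝕜 R} {M : ℕ}
    (hJ : J ^ M = ⊥) {a : R} (ha : a ∈ J) : IsNilpotent a :=
  ⟨M, by
    have := Submodule.pow_mem_pow J ha M
    rwa [hJ] at this⟩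

theorem nilEval_mem {R : Type*} [Ring R] [Algebra 𝕜 R] {J : Submodule 𝕜 R} (hJ : J * J ≤ J) {a : R}
    (ha : a ∈ J) {f : PowerSeries 𝕜} (hf : PowerSeries.constantCoeff f = 0) : nilEval a f ∈ J := by
  refine Submodule.sum_mem _ fun k _ => ?_
  cases k with
  | zero => simp [hf]
  | succ k =>
    refine J.smul_mem _ ?_
    clear * - hJ ha
    induction k with
    | zero => simpa using ha
    | succ k ih =>
      rw [pow_succ]
      exact hJ (Submodule.mul_mem_mul ih ha)

theorem nestedBracket_map_monomial :
    ∀ l : List A, nestedBracket (l.map fun a => (monomial 1 a : A[X])) =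
      monomial l.length (nestedBracket l)
  | [] => by simp [nestedBracket]
  | [a] => by simp [nestedBracket]
  | a :: b :: l => by
      have h := nestedBracket_map_monomial (b :: l)
      simp only [List.map_cons] at h
      simp only [List.map_cons, nestedBracket, h, Ring.lie_def, List.length_cons,
        monomial_mul_monomial, map_sub]
      rw [add_comm 1]

theorem bchTerm_monomial (m : ℕ) (x y : A) :
    bchTerm 𝕜 m (monomial 1 x : A[X]) (monomial 1 y) = monomial m (bchTerm 𝕜 m x y) := by
  have h1 : ∀ {k : ℕ} (e : Fin k → ℕ × ℕ), dynkinWord e (monomial 1 x : A[X]) (monomial 1 y) =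
      (dynkinWord e x y).map fun a => (monomial 1 a : A[X]) := by
    intro k e
    simp [dynkinWord, List.map_flatten, List.map_ofFn, Function.comp_def]
  simp only [bchTerm, map_sum]
  refine Finset.sum_congr rfl fun k _ => Finset.sum_congr rfl fun e he => ?_
  rw [h1, nestedBracket_map_monomial, length_dynkinWord he, smul_monomial]

/-- The derivation `X d/dX` on polynomials with coefficients in `A`. -/
noncomputable def eulerOp (𝕜 A : Type*) [Field 𝕜] [Ring A] [Algebra 𝕜 A] : Module.End 𝕜 A[X] :=
  LinearMap.mulLeft 𝕜 (X : A[X]) ∘ₗ (derivative (R := A)).restrictScalars 𝕜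

theorem eulerOp_apply (p : A[X]) : eulerOp 𝕜 A p = X * derivative p := rfl

theorem coeff_eulerOp (p : A[X]) (m : ℕ) : (eulerOp 𝕜 A p).coeff m = (m : 𝕜) • p.coeff m := by
  rw [eulerOp_apply]
  cases m with
  | zero => simp
  | succ m =>
    rw [coeff_X_mul, coeff_derivative, ← Nat.cast_succ, Nat.cast_smul_eq_nsmul, nsmul_eq_mul,
      Nat.cast_comm]

theorem lie_eulerOp_lmul (p : A[X]) :
    ⁅eulerOp 𝕜 A, Algebra.lmul 𝕜 A[X] p⁆ = Algebra.lmul 𝕜 A[X] (eulerOp 𝕜 A p) := by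
  refine LinearMap.ext fun q => ?_
  rw [Ring.lie_def]
  simp only [LinearMap.sub_apply, Module.End.mul_apply, Algebra.coe_lmul_eq_mul,
    LinearMap.mul_apply', eulerOp_apply, derivative_mul, mul_add]
  rw [← mul_assoc X p, ((commute_X p).eq : X * p = p * X), mul_assoc p, add_sub_cancel_right,
    mul_assoc]

variable [CharZero 𝕜]

/-- The **Baker–Campbell–Hausdorff theorem** for a nilpotent subalgebra `I` of an associative
algebra, with Dynkin's form of the series. The elements `x X` and `y X` of `A[X]` have weight `1` for
the derivation `X d/dX`, so `lie_eq_sum_bchTerm` determines the coefficients of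
`z = log (exp (x X) exp (y X))`; the theorem is the value at `X = 1`. -/
theorem exp_sum_bchTerm {I : Submodule 𝕜 A} (hI : I * I ≤ I) {M : ℕ} (hM : I ^ M = ⊥)
    (hM0 : 0 < M) {x y : A} (hx : x ∈ I) (hy : y ∈ I) :
    nilEval (∑ m ∈ Finset.range M, bchTerm 𝕜 m x y) (PowerSeries.exp 𝕜) =
      nilEval x (PowerSeries.exp 𝕜) * nilEval y (PowerSeries.exp 𝕜) := by
  set J := polySubmodule I with hJdef
  have hJJ : J * J ≤ J := (polySubmodule_mul_le I I).trans (polySubmodule_mono hI)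
  have hJM : J ^ M = ⊥ := polySubmodule_pow_eq_bot hM hM0
  have hmem : ∀ a ∈ I, (monomial 1 a : A[X]) ∈ J := by
    intro a ha i
    rw [coeff_monomial]
    split_ifs
    · exact ha
    · exact I.zero_mem
  set x' : A[X] := monomial 1 x with hx'
  set y' : A[X] := monomial 1 y with hy'
  have nx := isNilpotent_of_mem hJM (hmem x hx)
  have ny := isNilpotent_of_mem hJM (hmem y hy)
  set w : A[X] := nilEval x' (PowerSeries.exp 𝕜) * nilEval y' (PowerSeries.exp 𝕜) - 1 with hw
  have hwJ : w ∈ J := by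
    have h1 : ∀ a ∈ J, nilEval a (PowerSeries.exp 𝕜) - 1 ∈ J := fun a ha => by
      rw [← nilEval_sub_one (isNilpotent_of_mem hJM ha)]
      exact nilEval_mem hJJ ha (by simp)
    have h2 : w = (nilEval x' (PowerSeries.exp 𝕜) - 1) * (nilEval y' (PowerSeries.exp 𝕜) - 1) +
        (nilEval x' (PowerSeries.exp 𝕜) - 1) + (nilEval y' (PowerSeries.exp 𝕜) - 1) := by
      rw [hw]; noncomm_ring
    rw [h2]
    have hx1 := h1 x' (hmem x hx)
    have hy1 := h1 y' (hmem y hy)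
    exact J.add_mem (J.add_mem (hJJ (Submodule.mul_mem_mul hx1 hy1)) hx1) hy1
  have nw := isNilpotent_of_mem hJM hwJ
  set z : A[X] := nilEval w (PowerSeries.log 𝕜) with hzdef
  have hzJ : z ∈ J := nilEval_mem hJJ hwJ (by simp)
  have nz := isNilpotent_of_mem hJM hzJ
  have hexp : nilEval z (PowerSeries.exp 𝕜) =
      nilEval x' (PowerSeries.exp 𝕜) * nilEval y' (PowerSeries.exp 𝕜) := by
    rw [hzdef, nilEval_exp_log nw, hw]; abel
  -- The derivation `X d/dX` becomes a commutator among the endomorphisms of `A[X]`.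
  let Λ : A[X] →ₐ[𝕜] Module.End 𝕜 A[X] := Algebra.lmul 𝕜 A[X]
  have hΛ : Function.Injective Λ := Algebra.lmul_injective
  have hEuler : ∀ a : A, eulerOp 𝕜 A (monomial 1 a) = monomial 1 a := by
    intro a
    rw [eulerOp_apply, derivative_monomial]
    simp [C_mul_X_eq_monomial]
  have key : eulerOp 𝕜 A z = ∑ m ∈ Finset.range M, (m : 𝕜) • bchTerm 𝕜 m x' y' := by
    apply hΛ
    have h1 := lie_eq_sum_bchTerm (𝕜 := 𝕜) (Ω := Module.End 𝕜 A[X])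
      (J := J.map Λ.toLinearMap) (M := M) (x := Λ x') (y := Λ y') (z := Λ z) (δ := eulerOp 𝕜 A)
      (by rw [← Submodule.map_pow, hJM, Submodule.map_bot])
      ⟨x', hmem x hx, rfl⟩ ⟨y', hmem y hy, rfl⟩ (nz.map Λ)
      (by rw [← map_nilEval nz, ← map_nilEval nx, ← map_nilEval ny, hexp, map_mul])
      (by rw [lie_eulerOp_lmul, hEuler])
      (by rw [lie_eulerOp_lmul, hEuler])
    rw [lie_eulerOp_lmul] at h1
    refine h1.trans ?_
    rw [map_sum]
    refine Finset.sum_congr rfl fun m _ => ?_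
    rw [map_smul]
    congr 1
    exact (map_bchTerm (𝕜 := 𝕜) (AlgHom.toLieHom Λ) m x' y').symm
  have hz0 : z.coeff 0 = 0 := by
    -- `X d/dX` does not see the constant coefficient of `z`, which vanishes by evaluation at `0`.
    let φ : A[X] →ₐ[𝕜] A := eval₂AlgHom (AlgHom.id 𝕜 A) 0 fun a => Commute.zero_right _
    have hφ : ∀ p : A[X], φ p = p.coeff 0 := by
      intro p
      exact (eval₂_at_zero _).trans rfl
    rw [← hφ, hzdef, map_nilEval nw, hw, map_sub, map_mul, map_nilEval nx, map_nilEval ny, hφ, hφ,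
      map_one]
    simp [coeff_monomial, nilEval_eq_sum (pow_one (0 : A))]
  have hcoeff : ∀ m, z.coeff m = if m < M then bchTerm 𝕜 m x y else 0 := by
    intro m
    rcases Nat.eq_zero_or_pos m with rfl | hm
    · rw [hz0, if_pos hM0]
      simp [bchTerm]
    · have h1 := congrArg (coeff · m) key
      simp only [coeff_eulerOp, finsetSum_coeff, coeff_smul, hx', hy', bchTerm_monomial,
        coeff_monomial] at h1
      have hm0 : (m : 𝕜) ≠ 0 := by exact_mod_cast hm.ne'
      apply smul_right_injective A hm0
      simp only [h1]
      simp [Finset.sum_ite_eq']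
  -- evaluation at `1`
  let ψ : A[X] →ₐ[𝕜] A := eval₂AlgHom (AlgHom.id 𝕜 A) 1 fun a => Commute.one_right _
  have hψ : ∀ p : A[X], ψ p = p.sum fun _ a => a := by
    intro p
    refine (eval₂_eq_sum).trans ?_
    simp
  have hψm : ∀ a : A, ψ (monomial 1 a) = a := fun a => by rw [hψ, sum_monomial_index _ _ rfl]
  have hψz : ψ z = ∑ m ∈ Finset.range M, bchTerm 𝕜 m x y := by
    rw [hψ, sum_over_range' z (fun _ => rfl) (z.natDegree + 1 + M) (by omega)]
    simp only [hcoeff]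
    rw [← Finset.sum_filter]
    refine Finset.sum_congr ?_ fun _ _ => rfl
    ext m
    simp only [Finset.mem_filter, Finset.mem_range]
    omega
  rw [← hψz, ← map_nilEval nz, hexp, map_mul, map_nilEval nx, map_nilEval ny, hψm, hψm]

end BCHTheorem

/-! ### The adjoint action of the groups `G_L` and of `G` -/

section ExpAd

open ClusterScattering LieAlgebra

attribute [local instance] LieRing.ofAssociativeRing

variable (𝕜 : Type*) {𝔫 : Type*} [Field 𝕜] [LieRing 𝔫] [LieAlgebra 𝕜 𝔫]

/-- The endomorphisms of a Lie algebra which map each term of the lower central series to the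
next one. -/
def lcsShift (𝕜 𝔫 : Type*) [Field 𝕜] [LieRing 𝔫] [LieAlgebra 𝕜 𝔫] :
    Submodule 𝕜 (Module.End 𝕜 𝔫) where
  carrier := {a | ∀ i, ∀ v ∈ LieModule.lowerCentralSeries 𝕜 𝔫 𝔫 i,
    a v ∈ LieModule.lowerCentralSeries 𝕜 𝔫 𝔫 (i + 1)}
  add_mem' ha hb i v hv := add_mem (ha i v hv) (hb i v hv)
  zero_mem' _ _ _ := zero_mem _
  smul_mem' c _ ha i v hv := Submodule.smul_mem _ c (ha i v hv)

theorem lcsShift_mul_le : lcsShift 𝕜 𝔫 * lcsShift 𝕜 𝔫 ≤ lcsShift 𝕜 𝔫 :=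
  Submodule.mul_le.2 fun _ ha _ hb i v hv =>
    LieModule.antitone_lowerCentralSeries 𝕜 𝔫 𝔫 (by omega) (ha _ _ (hb i v hv))

theorem lcsShift_pow_apply (k : ℕ) {a : Module.End 𝕜 𝔫} (ha : a ∈ lcsShift 𝕜 𝔫 ^ k) (i : ℕ) {v : 𝔫}
    (hv : v ∈ LieModule.lowerCentralSeries 𝕜 𝔫 𝔫 i) :
    a v ∈ LieModule.lowerCentralSeries 𝕜 𝔫 𝔫 (i + k) := by
  induction k generalizing a i v with
  | zero =>
    rw [pow_zero, Submodule.mem_one] at ha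
    obtain ⟨c, rfl⟩ := ha
    rw [Module.algebraMap_end_apply]
    exact Submodule.smul_mem _ c hv
  | succ k ih =>
    rw [pow_succ] at ha
    refine Submodule.mul_induction_on ha (fun b hb c hc => ?_) fun b c hb hc => ?_
    · have := ih hb (i + 1) (hc i v hv)
      rwa [add_right_comm] at this
    · exact add_mem hb hc

theorem ad_mem_lcsShift (x : 𝔫) : ad 𝕜 𝔫 x ∈ lcsShift 𝕜 𝔫 := by
  intro i v hv
  rw [LieModule.lowerCentralSeries_succ]
  exact LieSubmodule.lie_mem_lie (LieSubmodule.mem_top x) hv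

theorem bch_eq_sum {A : Type*} [Ring A] [Algebra 𝕜 A] {J : Submodule 𝕜 A} {M : ℕ}
    (hJ : J ^ M = ⊥) {x y : A} (hx : x ∈ J) (hy : y ∈ J) :
    bch 𝕜 x y = ∑ m ∈ Finset.range M, bchTerm 𝕜 m x y := by
  refine finsum_eq_sum_of_support_subset _ fun m hm => ?_
  by_contra hmM
  rw [Finset.mem_coe, Finset.mem_range, not_lt] at hmM
  exact hm (bchTerm_eq_zero_of_pow_eq_bot hJ hx hy hmM)

theorem exists_lcsShift_pow_eq_bot (𝔫 : Type*) [LieRing 𝔫] [LieAlgebra 𝕜 𝔫]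
    [LieRing.IsNilpotent 𝔫] : ∃ M, 0 < M ∧ lcsShift 𝕜 𝔫 ^ M = ⊥ := by
  obtain ⟨K, hK⟩ := LieModule.IsNilpotent.nilpotent 𝕜 𝔫 𝔫
  refine ⟨K + 1, by omega, (Submodule.eq_bot_iff _).2 fun a ha => LinearMap.ext fun v => ?_⟩
  have h1 := lcsShift_pow_apply 𝕜 (K + 1) ha 0 (v := v) (by simp)
  have h2 := LieModule.antitone_lowerCentralSeries 𝕜 𝔫 𝔫 (by omega : K ≤ 0 + (K + 1)) h1
  rw [hK] at h2
  exact h2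

theorem isNilpotent_ad_of_nilpotent [LieRing.IsNilpotent 𝔫] (x : 𝔫) :
    IsNilpotent (ad 𝕜 𝔫 x) := by
  obtain ⟨M, -, hM⟩ := exists_lcsShift_pow_eq_bot 𝕜 𝔫
  exact isNilpotent_of_mem hM (ad_mem_lcsShift 𝕜 x)

variable [CharZero 𝕜]

/-- The automorphism `exp (ad x)` of a nilpotent Lie algebra, as a linear map. -/
noncomputable def expAd (x : 𝔫) : Module.End 𝕜 𝔫 := nilEval (ad 𝕜 𝔫 x) (PowerSeries.exp 𝕜)

theorem expAd_zero : expAd 𝕜 (0 : 𝔫) = 1 := by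
  rw [expAd, map_zero, nilEval_zero_exp]

theorem expAd_commute {x y : 𝔫} (h : ⁅x, y⁆ = 0) : Commute (expAd 𝕜 x) (expAd 𝕜 y) := by
  refine nilEval_commute ?_ _ _
  rw [commute_iff_lie_eq, ← LieHom.map_lie, h, map_zero]

variable [LieRing.IsNilpotent 𝔫]

/-- `exp X ↦ exp (ad X)` is a homomorphism from the group of a nilpotent Lie algebra: the
Baker–Campbell–Hausdorff theorem for the endomorphisms `ad x` and `ad y`, which lie in the nilpotent
algebra `lcsShift`. -/
theorem expAd_bch (x y : 𝔫) : expAd 𝕜 (bch 𝕜 x y) = expAd 𝕜 x * expAd 𝕜 y := by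
  obtain ⟨M, hM0, hM⟩ := exists_lcsShift_pow_eq_bot 𝕜 𝔫
  have h1 := exp_sum_bchTerm (𝕜 := 𝕜) (A := Module.End 𝕜 𝔫) (I := lcsShift 𝕜 𝔫)
    (x := ad 𝕜 𝔫 x) (y := ad 𝕜 𝔫 y) (lcsShift_mul_le 𝕜) hM hM0 (ad_mem_lcsShift 𝕜 x)
    (ad_mem_lcsShift 𝕜 y)
  have h2 : ad 𝕜 𝔫 (bch 𝕜 x y) = bch 𝕜 (ad 𝕜 𝔫 x) (ad 𝕜 𝔫 y) := map_bch (ad 𝕜 𝔫) x y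
  rw [expAd, h2, bch_eq_sum 𝕜 hM (ad_mem_lcsShift 𝕜 x) (ad_mem_lcsShift 𝕜 y)]
  exact h1

theorem ad_eq_of_expAd_eq {x y : 𝔫} (h : expAd 𝕜 x = expAd 𝕜 y) : ad 𝕜 𝔫 x = ad 𝕜 𝔫 y :=
  nilEval_exp_injective (isNilpotent_ad_of_nilpotent 𝕜 x) (isNilpotent_ad_of_nilpotent 𝕜 y) h

theorem expAd_add_smul (x : 𝔫) (a b : 𝕜) :
    expAd 𝕜 ((a + b) • x) = expAd 𝕜 (a • x) * expAd 𝕜 (b • x) := by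
  simp only [expAd, map_smul]
  exact nilEval_add_smul_exp (isNilpotent_ad_of_nilpotent 𝕜 x) a b

end ExpAd

namespace ClusterScattering.SkewLattice

section Faithful

variable {N : Type*} [AddCommGroup N] {D : SkewLattice N} {𝕜 : Type*} [Field 𝕜]

theorem form_self (D : SkewLattice N) (x : N) : D.form x x = 0 := by
  have := D.skew x x
  linarith

/-- The elements `e₁`, `e₂` of `N⁺`. -/
noncomputable def basisPos (D : SkewLattice N) (i : Fin 2) : D.Pos :=
  ⟨D.basis i, by
    fin_cases i
    · exact ⟨1, 0, by simp, by simp⟩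
    · exact ⟨0, 1, by simp, by simp⟩⟩

theorem deg_basisPos (i : Fin 2) : D.deg (D.basisPos i) = 1 := by
  fin_cases i <;> simp [deg, basisPos]

/-- A nonzero skew form on a lattice of rank `2` is nondegenerate. -/
theorem exists_pform_basisPos_ne_zero (hD : ∃ m n : D.Pos, D.pform m n ≠ 0) (n : D.Pos) :
    ∃ i, D.pform n (D.basisPos i) ≠ 0 := by
  have h01 : D.form (D.basis 0) (D.basis 1) ≠ 0 := by
    intro h0
    obtain ⟨⟨_, a₁, a₂, ha, rfl⟩, ⟨_, b₁, b₂, hb, rfl⟩, h⟩ := hD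
    refine h ?_
    simp [pform, D.skew (D.basis 1) (D.basis 0), h0, form_self]
  obtain ⟨_, a₁, a₂, ha, rfl⟩ := n
  by_contra! h
  have h0 := h 0
  have h1 := h 1
  simp [pform, basisPos, D.skew (D.basis 1) (D.basis 0), h01, form_self] at h0 h1
  omega

/-- The set `{n ∈ N⁺ ∣ deg n > K}`. -/
def degCut (D : SkewLattice N) (K : ℕ) : D.Cut where
  carrier := {n | (K : ℤ) < D.deg n}
  add_mem m n hn := by
    have := deg_pos m
    simp only [Set.mem_ofPred_eq, deg_add] at hn ⊢
    omega
  finite_compl := by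
    have h1 : ((fun p : ℕ × ℕ => p.1 • D.basis 0 + p.2 • D.basis 1) ''
        (Set.Iic (K, K))).Finite := (Set.finite_Iic _).image _
    refine (h1.preimage Subtype.val_injective.injOn).subset ?_
    rintro ⟨_, a₁, a₂, ha, rfl⟩ h
    refine ⟨(a₁, a₂), ?_, rfl⟩
    have h2 : ¬ (K : ℤ) < D.deg _ := h
    simp only [deg] at h2
    simp at h2
    simp only [Set.mem_Iic, Prod.mk_le_mk]
    omega

theorem exists_deg_le (L : D.Cut) : ∃ K : ℕ, ∀ n ∉ L.carrier, D.deg n ≤ K := by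
  obtain ⟨B, hB⟩ := (L.finite_compl.image D.deg).bddAbove
  exact ⟨B.toNat, fun n hn => (hB ⟨n, hn, rfl⟩).trans (Int.self_le_toNat B)⟩

/-- The coefficient of `X_n`. -/
noncomputable def coord (𝕜 : Type*) [Field 𝕜] (n : D.Pos) : D.LieAlg 𝕜 →ₗ[𝕜] 𝕜 :=
  (XBasis D 𝕜).coord n

theorem coord_X [DecidableEq D.Pos] (m n : D.Pos) :
    coord 𝕜 n (X 𝕜 m) = if m = n then 1 else 0 := by
  simp [coord, X, Finsupp.single_apply]

theorem mem_supportedOn_iff {S : Set D.Pos} {f : D.LieAlg 𝕜} :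
    f ∈ supportedOn D 𝕜 S ↔ ∀ n ∉ S, coord 𝕜 n f = 0 :=
  Finsupp.mem_supported' 𝕜 f

theorem Pos.add_right_cancel {a b m : D.Pos} (h : a + m = b + m) : a = b :=
  Subtype.ext (_root_.add_right_cancel (congrArg Subtype.val h))

variable [CharZero 𝕜]

theorem coord_lie_X (f : D.LieAlg 𝕜) (n m : D.Pos) :
    coord 𝕜 (n + m) ⁅f, X 𝕜 m⁆ = (D.pform n m : 𝕜) * coord 𝕜 n f := by
  classical
  have : (coord 𝕜 (n + m)) ∘ₗ (bracketMap D 𝕜).flip (X 𝕜 m) =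
      (D.pform n m : 𝕜) • coord 𝕜 n := by
    refine hom_ext fun k => ?_
    simp only [LinearMap.comp_apply, LinearMap.flip_apply, bracketMap_X, map_smul, coord_X,
      LinearMap.smul_apply]
    by_cases hk : k = n
    · simp [hk]
    · have : k + m ≠ n + m := fun h => hk (Pos.add_right_cancel h)
      simp [hk, this]
  exact LinearMap.congr_fun this f

theorem toQuot_eq_zero_iff {L : D.Cut} {f : D.LieAlg 𝕜} :
    L.toQuot 𝕜 f = 0 ↔ ∀ n ∉ L.carrier, coord 𝕜 n f = 0 :=
  (Submodule.Quotient.mk_eq_zero _).trans mem_supportedOn_iff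

/-- The center of `𝔤_{L'}` maps to `0` in `𝔤_L` if `L'` is small enough. -/
theorem exists_trans_eq_zero_of_central (hD : ∃ m n : D.Pos, D.pform m n ≠ 0) (L : D.Cut) :
    ∃ (L' : D.Cut) (h : L' ≤ L), ∀ z : L'.Quot 𝕜, (∀ y : L'.Quot 𝕜, ⁅z, y⁆ = 0) →
      Cut.trans 𝕜 h z = 0 := by
  obtain ⟨K, hK⟩ := exists_deg_le L
  have hle : D.degCut (K + 1) ≤ L := by
    intro n hn
    by_contra h
    have h1 := hK n h
    have h2 : ((K + 1 : ℕ) : ℤ) < D.deg n := hn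
    push_cast at h2
    omega
  refine ⟨D.degCut (K + 1), hle, fun z hz => ?_⟩
  obtain ⟨f, rfl⟩ := Cut.toQuot_surjective _ z
  rw [Cut.trans_toQuot, toQuot_eq_zero_iff]
  intro n hn
  obtain ⟨i, hi⟩ := exists_pform_basisPos_ne_zero hD n
  have h1 := hz (Cut.toQuot 𝕜 _ (X 𝕜 (D.basisPos i)))
  rw [← Cut.toQuot_lie, toQuot_eq_zero_iff] at h1
  have h2 := h1 (n + D.basisPos i) fun h => by
    have h2 : ((K + 1 : ℕ) : ℤ) < D.deg (n + D.basisPos i) := h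
    rw [deg_add, deg_basisPos] at h2
    have := hK n hn
    push_cast at h2
    omega
  rw [coord_lie_X] at h2
  exact (mul_eq_zero.1 h2).resolve_left (by exact_mod_cast hi)

theorem G.ext_proj {g h : D.G 𝕜} (H : ∀ L, G.proj L g = G.proj L h) : g = h :=
  Subtype.ext (funext H)

theorem G.proj_mul (L : D.Cut) (g h : D.G 𝕜) : G.proj L (g * h) = G.proj L g * G.proj L h := rfl

theorem G.proj_one (L : D.Cut) : G.proj L (1 : D.G 𝕜) = 1 := rfl

/-- The adjoint action of `G` on `𝔤_L`. -/
noncomputable def G.act (L : D.Cut) (g : D.G 𝕜) : Module.End 𝕜 (L.Quot 𝕜) :=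
  expAd 𝕜 (G.proj L g).log

theorem G.act_mul (L : D.Cut) (g h : D.G 𝕜) : G.act L (g * h) = G.act L g * G.act L h :=
  expAd_bch 𝕜 _ _

theorem G.act_one (L : D.Cut) : G.act L (1 : D.G 𝕜) = 1 := expAd_zero 𝕜

/-- The adjoint actions of `G` on the quotients `𝔤_L` are jointly faithful. -/
theorem G.ext_act (hD : ∃ m n : D.Pos, D.pform m n ≠ 0) {g h : D.G 𝕜}
    (H : ∀ L, G.act L g = G.act L h) : g = h := by
  refine G.ext_proj fun L => ?_
  obtain ⟨L', hL, hz⟩ := exists_trans_eq_zero_of_central (𝕜 := 𝕜) hD L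
  have h1 := ad_eq_of_expAd_eq 𝕜 (H L')
  have h2 := hz ((G.proj L' g).log - (G.proj L' h).log) fun y => by
    rw [sub_lie, ← LieAlgebra.ad_apply (R := 𝕜), ← LieAlgebra.ad_apply (R := 𝕜), h1, sub_self]
  rw [map_sub, sub_eq_zero] at h2
  have h3 : Cut.transGrp 𝕜 hL (G.proj L' g) = Cut.transGrp 𝕜 hL (G.proj L' h) :=
    congrArg ExpGroup.exp h2
  exact (g.2 L' L hL).symm.trans (h3.trans (h.2 L' L hL))

/-- Associativity of the product of `G` is inherited from the composition of endomorphisms, as `G`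
acts faithfully when the form is not zero. -/
theorem G.mul_assoc (hD : ∃ m n : D.Pos, D.pform m n ≠ 0) (a b c : D.G 𝕜) :
    a * b * c = a * (b * c) :=
  G.ext_act hD fun L => by simp only [G.act_mul, _root_.mul_assoc]

theorem G.one_mul (hD : ∃ m n : D.Pos, D.pform m n ≠ 0) (a : D.G 𝕜) : 1 * a = a :=
  G.ext_act hD fun L => by rw [G.act_mul, G.act_one, _root_.one_mul]

theorem G.mul_one (hD : ∃ m n : D.Pos, D.pform m n ≠ 0) (a : D.G 𝕜) : a * 1 = a :=
  G.ext_act hD fun L => by rw [G.act_mul, G.act_one, _root_.mul_one]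

theorem G.proj_surjective (L : D.Cut) : Function.Surjective (G.proj (𝕜 := 𝕜) L) := by
  rintro ⟨x⟩
  obtain ⟨f, rfl⟩ := L.toQuot_surjective x
  exact ⟨exp ⟨fun L' => L'.toQuot 𝕜 f, fun L' L'' h => Cut.trans_toQuot h f⟩, rfl⟩

/-- The monoid structure of `G_L`, with the product and the unit of `ExpGroup`. The laws are those of
`G`, which maps onto `G_L`. -/
noncomputable abbrev Cut.grpMonoid (hD : ∃ m n : D.Pos, D.pform m n ≠ 0) (L : D.Cut) :
    Monoid (L.Grp 𝕜) where
  mul_assoc a b c := by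
    obtain ⟨a, rfl⟩ := G.proj_surjective L a
    obtain ⟨b, rfl⟩ := G.proj_surjective L b
    obtain ⟨c, rfl⟩ := G.proj_surjective L c
    simp only [← G.proj_mul, G.mul_assoc hD]
  one_mul a := by
    obtain ⟨a, rfl⟩ := G.proj_surjective L a
    rw [← G.proj_one, ← G.proj_mul, G.one_mul hD]
  mul_one a := by
    obtain ⟨a, rfl⟩ := G.proj_surjective L a
    rw [← G.proj_one, ← G.proj_mul, G.mul_one hD]

end Faithful

end ClusterScattering.SkewLattice

/-! ### The action of the dilogarithm elements -/

section BinomialIdentity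

variable {R : Type*} [CommRing R] [BinomialRing R]

theorem sum_range_choose_mul_choose (r s : R) (k : ℕ) :
    ∑ i ∈ Finset.range (k + 1), Ring.choose r i * Ring.choose s (k - i) =
      Ring.choose (r + s) k := by
  rw [Ring.add_choose_eq k (Commute.all r s), Finset.Nat.sum_antidiagonal_eq_sum_range_succ_mk]

/-- The trinomial revision `C(β, n) C(β - n, l) = C(β, n + l) C(n + l, l)`. -/
theorem choose_mul_choose_sub (β : R) (n l : ℕ) :
    Ring.choose β n * Ring.choose (β - n) l = Ring.choose β (n + l) * ((n + l).choose l : ℕ) := by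
  have h := Ring.choose_smul_choose β (Nat.le_add_right n l)
  rw [Nat.add_sub_cancel_left] at h
  rw [← h, Nat.choose_symm_add, nsmul_eq_mul, mul_comm]

/-- The binomial identity behind the pentagon relation: both sides are the coefficient of
`x^A y^B` in `(1 + y)^β (1 + x + x y)^α`. -/
theorem sum_choose_pentagon (α β : R) (A B : ℕ) :
    ∑ r ∈ Finset.range (A + 1), (if r ≤ B then Ring.choose β (B - r) *
        Ring.choose (α + (β - (B - r : ℕ))) r * Ring.choose (α - B) (A - r) else 0) =
      Ring.choose α A * Ring.choose (β + A) B := by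
  let U : ℕ → ℕ → R := fun k l => if k ≤ B then
    Ring.choose α k * Ring.choose β (B - k) * ((B - k).choose l : ℕ) *
      Ring.choose (α - B) (A - (k + l)) else 0
  have h1 : ∀ r, (if r ≤ B then Ring.choose β (B - r) *
        Ring.choose (α + (β - (B - r : ℕ))) r * Ring.choose (α - B) (A - r) else 0) =
      ∑ k ∈ Finset.range (r + 1), U k (r - k) := by
    intro r
    split_ifs with hr
    · rw [← sum_range_choose_mul_choose, Finset.mul_sum, Finset.sum_mul]
      refine Finset.sum_congr rfl fun k hk => ?_
      have hk' : k ≤ r := Nat.lt_succ_iff.1 (Finset.mem_range.1 hk)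
      have e1 := choose_mul_choose_sub β (B - r) (r - k)
      rw [show B - r + (r - k) = B - k by omega] at e1
      simp only [U, if_pos (hk'.trans hr), Nat.add_sub_cancel' hk']
      linear_combination Ring.choose α k * Ring.choose (α - B) (A - r) * e1
    · refine (Finset.sum_eq_zero fun k hk => ?_).symm
      have hk' : k ≤ r := Nat.lt_succ_iff.1 (Finset.mem_range.1 hk)
      simp only [U]
      split_ifs with hkB
      · rw [Nat.choose_eq_zero_of_lt (by omega : B - k < r - k)]
        simp
      · rfl
  simp only [h1]
  rw [Finset.sum_range_diag_flip (A + 1) U]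
  have h2 : ∀ k ∈ Finset.range (A + 1), ∑ l ∈ Finset.range (A + 1 - k), U k l =
      if k ≤ B then Ring.choose α A * ((A.choose k : ℕ) * Ring.choose β (B - k)) else 0 := by
    intro k hk
    have hk' : k ≤ A := Nat.lt_succ_iff.1 (Finset.mem_range.1 hk)
    split_ifs with hkB
    · have e1 := sum_range_choose_mul_choose (((B - k : ℕ) : R)) (α - B) (A - k)
      have e2 : ((B - k : ℕ) : R) + (α - B) = α - k := by
        rw [Nat.cast_sub hkB]; ring
      have e3 := Ring.choose_smul_choose α hk'
      rw [e2] at e1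
      rw [nsmul_eq_mul, ← e1, Finset.mul_sum] at e3
      have e4 : Ring.choose α A * ((A.choose k : ℕ) * Ring.choose β (B - k)) =
          ((A.choose k : ℕ) * Ring.choose α A) * Ring.choose β (B - k) := by ring
      rw [e4, e3, Finset.sum_mul, show A + 1 - k = A - k + 1 by omega]
      refine Finset.sum_congr rfl fun l _ => ?_
      simp only [U, if_pos hkB, Ring.choose_natCast, Nat.sub_add_eq]
      ring
    · refine Finset.sum_eq_zero fun l _ => ?_
      simp only [U, if_neg hkB]
  rw [Finset.sum_congr rfl h2]
  rw [add_comm β, ← sum_range_choose_mul_choose, Finset.mul_sum]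
  have h3 : ∑ k ∈ Finset.range (A + 1), (if k ≤ B then
      Ring.choose α A * ((A.choose k : ℕ) * Ring.choose β (B - k)) else 0) =
      ∑ k ∈ Finset.range (A + 1 + (B + 1)), (if k ≤ B then
      Ring.choose α A * ((A.choose k : ℕ) * Ring.choose β (B - k)) else 0) := by
    refine Finset.sum_subset (Finset.range_mono (by omega)) fun k _ hk => ?_
    rw [Finset.mem_range, not_lt] at hk
    rw [Nat.choose_eq_zero_of_lt (by omega)]
    simp
  have h4 : ∑ k ∈ Finset.range (B + 1), Ring.choose α A *
      (Ring.choose (A : R) k * Ring.choose β (B - k)) =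
      ∑ k ∈ Finset.range (A + 1 + (B + 1)), (if k ≤ B then
      Ring.choose α A * ((A.choose k : ℕ) * Ring.choose β (B - k)) else 0) := by
    rw [← Finset.sum_subset (Finset.range_mono (by omega : B + 1 ≤ A + 1 + (B + 1)))]
    · refine Finset.sum_congr rfl fun k hk => ?_
      rw [if_pos (Nat.lt_succ_iff.1 (Finset.mem_range.1 hk)), Ring.choose_natCast]
    · intro k _ hk
      rw [Finset.mem_range, not_lt] at hk
      rw [if_neg (by omega)]
  rw [h3, h4]

end BinomialIdentity

namespace ClusterScattering.SkewLattice

section Strings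

open PowerSeries

variable {N : Type*} [AddCommGroup N] {D : SkewLattice N} {𝕜 : Type*} [Field 𝕜] [CharZero 𝕜]

/-- The underlying set of `N⁺` in `N`. -/
def IsPos (D : SkewLattice N) (u : N) : Prop :=
  ∃ a₁ a₂ : ℕ, 0 < a₁ + a₂ ∧ u = a₁ • D.basis 0 + a₂ • D.basis 1

theorem IsPos.add_nsmul {u : N} (hu : D.IsPos u) (n : D.Pos) (j : ℕ) : D.IsPos (u + j • n.1) := by
  obtain ⟨a₁, a₂, ha, rfl⟩ := hu
  obtain ⟨_, b₁, b₂, hb, rfl⟩ := n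
  refine ⟨a₁ + j * b₁, a₂ + j * b₂, by omega, ?_⟩
  simp only [smul_add, add_smul, mul_smul]
  abel

open Classical in
/-- The image of `X_u` in `𝔤_L` for `u ∈ N⁺`, and `0` for all other `u ∈ N`. -/
noncomputable def xImage (𝕜 : Type*) [Field 𝕜] [CharZero 𝕜] (L : D.Cut) (u : N) : L.Quot 𝕜 :=
  if h : D.IsPos u then L.toQuot 𝕜 (X 𝕜 ⟨u, h⟩) else 0

theorem xImage_coe (L : D.Cut) (m : D.Pos) : xImage 𝕜 L m.1 = L.toQuot 𝕜 (X 𝕜 m) :=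
  dif_pos m.2

theorem lie_toQuot_X_xImage (L : D.Cut) (m : D.Pos) {u : N} (hu : D.IsPos u) :
    ⁅L.toQuot 𝕜 (X 𝕜 m), xImage 𝕜 L u⁆ = (D.form m.1 u : 𝕜) • xImage 𝕜 L (u + m.1) := by
  obtain ⟨q, rfl⟩ : ∃ q : D.Pos, q.1 = u := ⟨⟨u, hu⟩, rfl⟩
  have h2 : xImage 𝕜 L (q.1 + m.1) = L.toQuot 𝕜 (X 𝕜 (m + q)) := by
    rw [← xImage_coe, Pos.coe_add, add_comm]
  rw [xImage_coe, h2, ← Cut.toQuot_lie, lie_X, map_smul]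
  rfl

/-- In `𝔤_L`, the strings `X_u, X_{u+n}, X_{u+2n}, …` with `u ∈ N⁺` vanish from some point on which
depends only on `L`. -/
theorem exists_xImage_eq_zero (𝕜 : Type*) [Field 𝕜] [CharZero 𝕜] (L : D.Cut) :
    ∃ K : ℕ, ∀ u : N, D.IsPos u → ∀ n : D.Pos, ∀ j, K ≤ j → xImage 𝕜 L (u + j • n.1) = 0 := by
  obtain ⟨K, hK⟩ := exists_deg_le L
  refine ⟨K, fun u hu n j hj => ?_⟩
  have hp := hu.add_nsmul n j
  refine (xImage_coe L ⟨_, hp⟩).trans (L.toQuot_X ?_)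
  by_contra hmem
  have h1 := hK _ hmem
  have h2 := deg_pos ⟨u, hu⟩
  have h3 := deg_pos n
  have h4 : D.deg ⟨_, hp⟩ = D.deg ⟨u, hu⟩ + j * D.deg n := by
    simp [deg]
    ring
  have h5 : (K : ℤ) ≤ j := by exact_mod_cast hj
  nlinarith

/-- In `𝔤_L`, the series `log [n]` may be summed over `j < K` (with the index shifted by one) if the
string of the multiples of `n` vanishes from `K` on. -/
theorem dilogSum_apply {L : D.Cut} {n : D.Pos} {K : ℕ}
    (hK : ∀ j, K ≤ j → xImage 𝕜 L ((j + 1) • n.1) = 0) :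
    (dilogSum 𝕜 n).1 L = ∑ j ∈ Finset.range K,
      ((-1 : 𝕜) ^ (j + 2) / ((j + 1 : ℕ) : 𝕜) ^ 2) • L.toQuot 𝕜 (X 𝕜 (Pos.mul (Nat.succPNat j) n)) := by
  have h1 : (dilogSum 𝕜 n).1 L = ∑ᶠ j : ℕ+,
      L.toQuot 𝕜 (((-1 : 𝕜) ^ ((j : ℕ) + 1) / ((j : ℕ) : 𝕜) ^ 2) • X 𝕜 (Pos.mul j n)) := rfl
  rw [h1, ← finsum_comp_equiv Equiv.pnatEquivNat.symm]
  simp only [map_smul]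
  refine finsum_eq_sum_of_support_subset _ fun j hj => ?_
  by_contra hjK
  rw [Finset.mem_coe, Finset.mem_range, not_lt] at hjK
  refine hj ?_
  have h2 := xImage_coe (𝕜 := 𝕜) L (Pos.mul (Nat.succPNat j) n)
  have h3 : (Pos.mul (Nat.succPNat j) n).1 = (j + 1) • n.1 := rfl
  rw [h3, hK j hjK] at h2
  simp only [Equiv.pnatEquivNat_symm_apply, ← h2, smul_zero]

/-- The factors `j` in `{j n, u}` turn the coefficients `(-1)^{j+1}/j²` of `log [n]` into those of
`log (1 + T)`. -/
theorem lie_dilogSum_xImage {L : D.Cut} {n : D.Pos} {K : ℕ} {u : N} (hu : D.IsPos u)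
    (hn : ∀ j, K ≤ j → xImage 𝕜 L ((j + 1) • n.1) = 0)
    (hK : ∀ j, K ≤ j → xImage 𝕜 L (u + j • n.1) = 0) :
    ⁅(dilogSum 𝕜 n).1 L, xImage 𝕜 L u⁆ = ∑ j ∈ Finset.range K,
      ((D.form n.1 u : 𝕜) * coeff j (log 𝕜)) • xImage 𝕜 L (u + j • n.1) := by
  rw [dilogSum_apply hn, sum_lie]
  have h1 : ∑ j ∈ Finset.range K,
      ((D.form n.1 u : 𝕜) * coeff j (log 𝕜)) • xImage 𝕜 L (u + j • n.1) =
      ∑ j ∈ Finset.range (K + 1),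
      ((D.form n.1 u : 𝕜) * coeff j (log 𝕜)) • xImage 𝕜 L (u + j • n.1) := by
    rw [Finset.sum_range_succ, hK K le_rfl, smul_zero, add_zero]
  rw [h1, Finset.sum_range_succ']
  have h0 : coeff 0 (log 𝕜) = 0 := by simp
  rw [h0, mul_zero, zero_smul, add_zero]
  refine Finset.sum_congr rfl fun j _ => ?_
  rw [smul_lie, lie_toQuot_X_xImage L _ hu, smul_smul]
  have h3 : (Pos.mul (Nat.succPNat j) n).1 = (j + 1) • n.1 := rfl
  rw [h3]
  congr 1
  have h4 : ((j : 𝕜) + 1) ≠ 0 := by exact_mod_cast Nat.succ_ne_zero j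
  rw [coeff_log]
  simp
  field_simp

/-- The linear map `∑ fₖ Tᵏ ↦ ∑_{k < K} fₖ X_{u+kn}` from power series to `𝔤_L`. -/
noncomputable def stringMap (𝕜 : Type*) [Field 𝕜] [CharZero 𝕜] (L : D.Cut) (n : D.Pos) (K : ℕ)
    (u : N) : 𝕜⟦X⟧ →ₗ[𝕜] L.Quot 𝕜 :=
  ∑ k ∈ Finset.range K, (coeff k).smulRight (xImage 𝕜 L (u + k • n.1))

theorem stringMap_apply (L : D.Cut) (n : D.Pos) (K : ℕ) (u : N) (f : 𝕜⟦X⟧) :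
    stringMap 𝕜 L n K u f = ∑ k ∈ Finset.range K, coeff k f • xImage 𝕜 L (u + k • n.1) := by
  simp [stringMap]

/-- The adjoint action of `log [n]` on the string through `X_u` is multiplication by
`{n, u} log (1 + T)`. -/
theorem lie_dilogSum_stringMap {L : D.Cut} {n : D.Pos} {K : ℕ}
    (hK : ∀ u : N, D.IsPos u → ∀ n : D.Pos, ∀ j, K ≤ j → xImage 𝕜 L (u + j • n.1) = 0)
    {u : N} (hu : D.IsPos u) (f : 𝕜⟦X⟧) :
    ⁅(dilogSum 𝕜 n).1 L, stringMap 𝕜 L n K u f⁆ =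
      stringMap 𝕜 L n K u (((D.form n.1 u : 𝕜) • log 𝕜) * f) := by
  have hn : ∀ j, K ≤ j → xImage 𝕜 L ((j + 1) • n.1) = 0 := fun j hj => by
    rw [add_smul, one_smul, add_comm]
    exact hK n.1 n.2 n j hj
  rw [stringMap_apply, stringMap_apply, lie_sum]
  have h1 : ∀ i ∈ Finset.range K,
      coeff i (((D.form n.1 u : 𝕜) • log 𝕜) * f) • xImage 𝕜 L (u + i • n.1) =
      ∑ k ∈ Finset.range (i + 1), (coeff k f * ((D.form n.1 u : 𝕜) * coeff (i - k) (log 𝕜))) •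
        xImage 𝕜 L (u + (k + (i - k)) • n.1) := by
    intro i _
    rw [mul_comm, coeff_mul, Finset.Nat.sum_antidiagonal_eq_sum_range_succ_mk, Finset.sum_smul]
    refine Finset.sum_congr rfl fun k hk => ?_
    rw [Nat.add_sub_cancel' (Nat.lt_succ_iff.1 (Finset.mem_range.1 hk)), coeff_smul, smul_eq_mul]
  rw [Finset.sum_congr rfl h1, Finset.sum_range_diag_flip K fun k j =>
    (coeff k f * ((D.form n.1 u : 𝕜) * coeff j (log 𝕜))) • xImage 𝕜 L (u + (k + j) • n.1)]
  refine Finset.sum_congr rfl fun k _ => ?_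
  have hp := hu.add_nsmul n k
  rw [lie_smul, lie_dilogSum_xImage hp hn (hK _ hp n), Finset.smul_sum]
  symm
  refine (Finset.sum_subset (Finset.range_mono (Nat.sub_le K k)) fun j _ hj => ?_).trans ?_
  · rw [Finset.mem_range, not_lt] at hj
    rw [hK u hu n (k + j) (by omega), smul_zero]
  · refine Finset.sum_congr rfl fun j _ => ?_
    rw [smul_smul, add_smul, add_assoc, map_add, map_nsmul, form_self, smul_zero, add_zero]

theorem ad_smul_dilogSum_pow_stringMap {L : D.Cut} {n : D.Pos} {K : ℕ}
    (hK : ∀ u : N, D.IsPos u → ∀ n : D.Pos, ∀ j, K ≤ j → xImage 𝕜 L (u + j • n.1) = 0)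
    {u : N} (hu : D.IsPos u) (a : 𝕜) (r : ℕ) :
    ((LieAlgebra.ad 𝕜 (L.Quot 𝕜) (a • (dilogSum 𝕜 n).1 L)) ^ r) (stringMap 𝕜 L n K u 1) =
      stringMap 𝕜 L n K u (((a * (D.form n.1 u : 𝕜)) • log 𝕜) ^ r) := by
  induction r with
  | zero => simp
  | succ r ih =>
    rw [pow_succ', Module.End.mul_apply, ih, LieAlgebra.ad_apply, smul_lie,
      lie_dilogSum_stringMap hK hu, ← map_smul, pow_succ']
    simp only [mul_smul, smul_mul_assoc]

theorem proj_dilog_pow_log (L : D.Cut) (n : D.Pos) (s : ℚ) :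
    (G.proj L (dilog 𝕜 n ^ s)).log = (s : 𝕜) • (dilogSum 𝕜 n).1 L := rfl

/-- The action of `[n]^s` on `𝔤_L`: `X_u ↦ X_u (1 + T)^{s {n, u}}`, where `T` stands for the
shift by `n`. -/
theorem act_dilog_pow {L : D.Cut} {K : ℕ}
    (hK : ∀ u : N, D.IsPos u → ∀ n : D.Pos, ∀ j, K ≤ j → xImage 𝕜 L (u + j • n.1) = 0)
    (n : D.Pos) (s : ℚ) {u : N} (hu : D.IsPos u) :
    G.act L (dilog 𝕜 n ^ s) (xImage 𝕜 L u) = ∑ k ∈ Finset.range K,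
      Ring.choose (((s * D.form n.1 u : ℚ) : 𝕜)) k • xImage 𝕜 L (u + k • n.1) := by
  have hx : xImage 𝕜 L u = stringMap 𝕜 L n K u 1 := by
    rw [stringMap_apply]
    cases K with
    | zero => simpa using hK u hu n 0 le_rfl
    | succ K => simp [coeff_one]
  set a : 𝕜 := (s : 𝕜) * (D.form n.1 u : 𝕜) with ha
  have hs : HasSubst (a • log 𝕜) := HasSubst.of_constantCoeff_zero' (by simp)
  obtain ⟨R, hR⟩ := isNilpotent_ad_of_nilpotent 𝕜 ((s : 𝕜) • (dilogSum 𝕜 n).1 L)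
  have hR' := pow_eq_zero_of_le (Nat.le_add_left R K) hR
  rw [G.act, proj_dilog_pow_log, expAd, nilEval_eq_sum hR', hx, LinearMap.sum_apply]
  simp only [LinearMap.smul_apply, ad_smul_dilogSum_pow_stringMap hK hu, ← map_smul, ← map_sum]
  rw [stringMap_apply]
  refine Finset.sum_congr rfl fun k hk => ?_
  congr 1
  have hk' := Finset.mem_range.1 hk
  push_cast
  rw [← ha, ← coeff_exp_subst_smul_log, coeff_subst' hs, map_sum]
  symm
  refine (finsum_eq_sum_of_support_subset (s := Finset.range (K + R)) _ fun r hr => ?_).trans ?_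
  · by_contra hrK
    rw [Finset.mem_coe, Finset.mem_range, not_lt] at hrK
    refine hr ?_
    have hdvd : (PowerSeries.X : 𝕜⟦X⟧) ^ r ∣ (a • log 𝕜) ^ r :=
      pow_dvd_pow_of_dvd (X_dvd_iff.2 (by simp)) r
    simp only [X_pow_dvd_iff.1 hdvd k (by omega), smul_zero]
  · refine Finset.sum_congr rfl fun r _ => ?_
    rw [coeff_smul]

end Strings

end ClusterScattering.SkewLattice

/-! ### The pentagon relation -/

section SumShift

variable {R V : Type*} [Semiring R] [AddCommMonoid V] [Module R V]

theorem sum_smul_shift {K : ℕ} {y : ℕ → V} (hy : ∀ B, K ≤ B → y B = 0) (h : ℕ → R) (r : ℕ) :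
    ∑ i ∈ Finset.range K, h i • y (i + r) =
      ∑ B ∈ Finset.range K, (if r ≤ B then h (B - r) else 0) • y B := by
  have h1 : ∑ B ∈ Finset.range K, (if r ≤ B then h (B - r) else 0) • y B =
      ∑ B ∈ Finset.range (r + K), (if r ≤ B then h (B - r) else 0) • y B := by
    refine Finset.sum_subset (Finset.range_mono (by omega)) fun B _ hB => ?_
    rw [Finset.mem_range, not_lt] at hB
    rw [hy B hB, smul_zero]
  have h2 : ∑ B ∈ Finset.range r, (if r ≤ B then h (B - r) else 0) • y B = 0 :=
    Finset.sum_eq_zero fun B hB => by rw [if_neg (by simpa using hB), zero_smul]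
  rw [h1, Finset.sum_range_add, h2, zero_add]
  refine Finset.sum_congr rfl fun i _ => ?_
  rw [if_pos (by omega), Nat.add_sub_cancel_left, add_comm]

/-- Collecting the terms of a triple sum `∑ C(β, i) C(α + β - i, r) C(α - i - r, j) y_{r+j, i+r}` by
the indices of `y`. -/
theorem sum_choose_smul_pentagon {R V : Type*} [CommRing R] [BinomialRing R] [AddCommGroup V]
    [Module R V] {K : ℕ} {y : ℕ → ℕ → V} (hA : ∀ A B, K ≤ A → y A B = 0)
    (hB : ∀ A B, K ≤ B → y A B = 0) (α β : R) :
    ∑ i ∈ Finset.range K, Ring.choose β i • ∑ r ∈ Finset.range K,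
      Ring.choose (α + (β - i)) r • ∑ j ∈ Finset.range K, Ring.choose (α - i - r) j •
        y (j + r) (i + r) =
    ∑ A ∈ Finset.range K, Ring.choose α A • ∑ B ∈ Finset.range K, Ring.choose (β + A) B • y A B := by
  have h1 : ∀ i r : ℕ, ∑ j ∈ Finset.range K, Ring.choose (α - i - r) j • y (j + r) (i + r) =
      ∑ A ∈ Finset.range K, (if r ≤ A then Ring.choose (α - i - r) (A - r) else 0) •
        y A (i + r) := fun i r =>
    sum_smul_shift (y := fun A => y A (i + r)) (fun A => hA A _) (fun j => Ring.choose (α - i - r) j) r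
  simp only [h1, Finset.smul_sum, smul_smul]
  have h2 : ∀ A r : ℕ, ∑ i ∈ Finset.range K, (Ring.choose β i * (Ring.choose (α + (β - i)) r *
      if r ≤ A then Ring.choose (α - i - r) (A - r) else 0)) • y A (i + r) =
      ∑ B ∈ Finset.range K, (if r ≤ B then Ring.choose β (B - r) *
        (Ring.choose (α + (β - (B - r : ℕ))) r *
          if r ≤ A then Ring.choose (α - (B - r : ℕ) - r) (A - r) else 0) else 0) • y A B :=
    fun A r => sum_smul_shift (y := y A) (hB A) (fun i => Ring.choose β i *
      (Ring.choose (α + (β - i)) r * if r ≤ A then Ring.choose (α - i - r) (A - r) else 0)) r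
  have h3 : ∀ i : ℕ, ∑ r ∈ Finset.range K, ∑ A ∈ Finset.range K, (Ring.choose β i *
      (Ring.choose (α + (β - i)) r * if r ≤ A then Ring.choose (α - i - r) (A - r) else 0)) •
        y A (i + r) = ∑ A ∈ Finset.range K, ∑ r ∈ Finset.range K, (Ring.choose β i *
      (Ring.choose (α + (β - i)) r * if r ≤ A then Ring.choose (α - i - r) (A - r) else 0)) •
        y A (i + r) := fun i => Finset.sum_comm
  simp only [h3]
  rw [Finset.sum_comm]
  refine Finset.sum_congr rfl fun A hAK => ?_
  rw [Finset.sum_comm]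
  simp only [h2]
  rw [Finset.sum_comm]
  refine Finset.sum_congr rfl fun B _ => ?_
  rw [← Finset.sum_smul, ← sum_choose_pentagon]
  congr 1
  have hAK' := Finset.mem_range.1 hAK
  refine (Finset.sum_subset (Finset.range_mono (by omega : A + 1 ≤ K)) fun r _ hr => ?_).symm.trans
    (Finset.sum_congr rfl fun r hr => ?_)
  · have hr' : ¬ r ≤ A := by simpa [Nat.lt_succ_iff] using hr
    simp [if_neg hr']
  · have hr' : r ≤ A := Nat.lt_succ_iff.1 (Finset.mem_range.1 hr)
    split_ifs with hrB
    · rw [Nat.cast_sub hrB, mul_assoc]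
      congr 3
      ring
    · rfl

end SumShift

namespace ClusterScattering.SkewLattice

section Relations

variable {N : Type*} [AddCommGroup N] {D : SkewLattice N} {𝕜 : Type*} [Field 𝕜] [CharZero 𝕜]

theorem end_ext {L : D.Cut} {f g : Module.End 𝕜 (L.Quot 𝕜)}
    (h : ∀ v : D.Pos, f (xImage 𝕜 L v.1) = g (xImage 𝕜 L v.1)) : f = g := by
  have h1 : f ∘ₗ L.toQuot 𝕜 = g ∘ₗ L.toQuot 𝕜 := hom_ext fun v => by
    have := h v
    rw [xImage_coe] at this
    exact this
  refine LinearMap.ext fun x => ?_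
  obtain ⟨y, rfl⟩ := L.toQuot_surjective x
  exact LinearMap.congr_fun h1 y

/-- The pentagon relation, where `{n', n} = s⁻¹`. Both sides are compared on `X_v`; the coefficients of
`X_{v + A n + B n'}` agree by `sum_choose_pentagon` with `α = s {n, v}` and `β = s {n', v}`. -/
theorem pentagon {n n' : D.Pos} {s : ℚ} (h : D.pform n' n * s = 1) :
    dilog 𝕜 n' ^ s * dilog 𝕜 n ^ s = dilog 𝕜 n ^ s * dilog 𝕜 (n + n') ^ s * dilog 𝕜 n' ^ s := by
  have hD : ∃ m n : D.Pos, D.pform m n ≠ 0 := ⟨n', n, left_ne_zero_of_mul_eq_one h⟩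
  refine G.ext_act hD fun L => end_ext fun v => ?_
  obtain ⟨K, hK⟩ := exists_xImage_eq_zero 𝕜 L
  have hn : D.form n'.1 n.1 * s = 1 := h
  have hn' : D.form n.1 n'.1 * s = -1 := by rw [D.skew, neg_mul, hn]
  simp only [G.act_mul, Module.End.mul_apply]
  have hv : D.IsPos v.1 := v.2
  let y : ℕ → ℕ → L.Quot 𝕜 := fun A B => xImage 𝕜 L (v.1 + A • n.1 + B • n'.1)
  have hA : ∀ A B, K ≤ A → y A B = 0 := fun A B hAB => by
    simp only [y]
    rw [add_right_comm]
    exact hK _ (hv.add_nsmul n' B) n A hAB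
  have hB : ∀ A B, K ≤ B → y A B = 0 := fun A B hAB => hK _ (hv.add_nsmul n A) n' B hAB
  rw [act_dilog_pow hK n s hv, act_dilog_pow hK n' s hv]
  simp only [map_sum, map_smul]
  have e1 : ∀ A : ℕ, G.act L (dilog 𝕜 n' ^ s) (xImage 𝕜 L (v.1 + A • n.1)) =
      ∑ B ∈ Finset.range K, Ring.choose (((s * D.form n'.1 v.1 : ℚ) : 𝕜) + A) B • y A B := by
    intro A
    rw [act_dilog_pow hK n' s (hv.add_nsmul n A)]
    have : s * D.form n'.1 (v.1 + A • n.1) = s * D.form n'.1 v.1 + A := by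
      rw [map_add, map_nsmul, nsmul_eq_mul]
      linear_combination (A : ℚ) * hn
    rw [this]
    push_cast
    rfl
  have e2 : ∀ i : ℕ, G.act L (dilog 𝕜 n ^ s) (G.act L (dilog 𝕜 (n + n') ^ s)
      (xImage 𝕜 L (v.1 + i • n'.1))) =
      ∑ r ∈ Finset.range K, Ring.choose (((s * D.form n.1 v.1 : ℚ) : 𝕜) +
          (((s * D.form n'.1 v.1 : ℚ) : 𝕜) - i)) r • ∑ j ∈ Finset.range K,
          Ring.choose (((s * D.form n.1 v.1 : ℚ) : 𝕜) - i - r) j • y (j + r) (i + r) := by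
    intro i
    have hi := hv.add_nsmul n' i
    rw [act_dilog_pow hK (n + n') s hi, map_sum]
    have f1 : s * D.form (n + n').1 (v.1 + i • n'.1) =
        s * D.form n.1 v.1 + (s * D.form n'.1 v.1 - i) := by
      rw [Pos.coe_add, map_add, map_add, map_nsmul, LinearMap.add_apply, LinearMap.add_apply,
        form_self, nsmul_eq_mul]
      linear_combination (i : ℚ) * hn'
    rw [f1]
    push_cast
    refine Finset.sum_congr rfl fun r _ => ?_
    rw [map_smul, act_dilog_pow hK n s (hi.add_nsmul (n + n') r)]
    have f2 : s * D.form n.1 (v.1 + i • n'.1 + r • (n + n').1) = s * D.form n.1 v.1 - i - r := by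
      rw [Pos.coe_add, map_add, map_add, map_nsmul, map_nsmul, map_add, form_self, nsmul_eq_mul,
        nsmul_eq_mul]
      linear_combination ((i : ℚ) + r) * hn'
    rw [f2]
    push_cast
    congr 1
    refine Finset.sum_congr rfl fun j _ => ?_
    have f3 : v.1 + i • n'.1 + r • (n + n').1 + j • n.1 =
        v.1 + (j + r) • n.1 + (i + r) • n'.1 := by
      rw [Pos.coe_add]
      module
    rw [f3]
  simp only [e1, e2]
  exact (sum_choose_smul_pentagon hA hB _ _).symm

theorem dilog_pow_add (hD : ∃ m n : D.Pos, D.pform m n ≠ 0) (n : D.Pos) (s t : ℚ) :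
    dilog 𝕜 n ^ (s + t) = dilog 𝕜 n ^ s * dilog 𝕜 n ^ t := by
  refine G.ext_act hD fun L => ?_
  rw [G.act_mul, G.act, G.act, G.act, proj_dilog_pow_log, proj_dilog_pow_log, proj_dilog_pow_log,
    Rat.cast_add, expAd_add_smul]

theorem dilog_pow_commute (hD : ∃ m n : D.Pos, D.pform m n ≠ 0) {m n : D.Pos} (s t : ℚ)
    (h : D.pform m n = 0) :
    dilog 𝕜 m ^ s * dilog 𝕜 n ^ t = dilog 𝕜 n ^ t * dilog 𝕜 m ^ s := by
  refine G.ext_act hD fun L => ?_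
  rw [G.act_mul, G.act_mul, G.act, G.act, proj_dilog_pow_log, proj_dilog_pow_log]
  refine (expAd_commute 𝕜 ?_).eq
  rw [smul_lie, lie_smul]
  obtain ⟨K, hK⟩ := exists_xImage_eq_zero 𝕜 L
  have hK' : ∀ n : D.Pos, ∀ j, K ≤ j → xImage 𝕜 L ((j + 1) • n.1) = 0 := fun n j hj => by
    rw [add_smul, one_smul, add_comm]
    exact hK n.1 n.2 n j hj
  rw [dilogSum_apply (hK' m), dilogSum_apply (hK' n)]
  simp only [sum_lie, lie_sum, smul_lie, lie_smul, ← Cut.toQuot_lie, lie_X]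
  have h0 : ∀ i j : ℕ+, D.pform (Pos.mul i m) (Pos.mul j n) = 0 := by
    intro i j
    have h1 : D.form m.1 n.1 = 0 := h
    simp [pform, Pos.mul, h1]
  simp [h0]

/-- If `n ∈ L`, then `L` contains all multiples of `n`, so `[n]^s` is trivial in `G_L`. -/
theorem proj_dilog_pow_eq_one {L : D.Cut} {n : D.Pos} (h : n ∈ L.carrier) (s : ℚ) :
    G.proj L (dilog 𝕜 n ^ s) = 1 := by
  refine ExpGroup.ext ?_
  have h1 : (dilogSum 𝕜 n).1 L = 0 := by
    refine finsum_eq_zero_of_forall_eq_zero fun j => ?_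
    have h2 : ∀ j : ℕ+, Pos.mul j n ∈ L.carrier := fun j => by
      induction j using PNat.recOn with
      | one =>
        have : Pos.mul 1 n = n := Subtype.ext (one_smul ℕ n.1)
        rwa [this]
      | succ j ih =>
        have : Pos.mul (j + 1) n = n + Pos.mul j n := Subtype.ext (by
          rw [Pos.coe_add]
          exact (add_smul (j : ℕ) 1 n.1).trans (by rw [one_smul, add_comm]; rfl))
        rw [this]
        exact L.add_mem _ _ ih
    rw [map_smul, Cut.toQuot_X L (h2 j), smul_zero]
  rw [proj_dilog_pow_log, h1, smul_zero]
  rfl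

end Relations

end ClusterScattering.SkewLattice

/-! ### Ordered products in a monoid with the pentagon relation -/

section OrderedProducts

variable {H : Type*} [Monoid H]

/-- `f 0 * f 1 * ⋯ * f (l - 1)`. -/
def ltrProd (f : ℕ → H) (l : ℕ) : H := ((List.range l).map f).prod

/-- `f (l - 1) * ⋯ * f 1 * f 0`. -/
def rtlProd (f : ℕ → H) (l : ℕ) : H := ((List.range l).reverse.map f).prod

theorem ltrProd_zero (f : ℕ → H) : ltrProd f 0 = 1 := rfl

theorem rtlProd_zero (f : ℕ → H) : rtlProd f 0 = 1 := rfl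

theorem ltrProd_succ (f : ℕ → H) (l : ℕ) : ltrProd f (l + 1) = ltrProd f l * f l := by
  simp [ltrProd, List.range_succ]

theorem ltrProd_succ' (f : ℕ → H) (l : ℕ) :
    ltrProd f (l + 1) = f 0 * ltrProd (fun p => f (p + 1)) l := by
  simp [ltrProd, List.range_succ_eq_map, Function.comp_def]

theorem rtlProd_succ (f : ℕ → H) (l : ℕ) : rtlProd f (l + 1) = f l * rtlProd f l := by
  simp [rtlProd, List.range_succ]

theorem ltrProd_stable {f : ℕ → H} {m l : ℕ} (hf : ∀ p, m ≤ p → f p = 1) (h : m ≤ l) :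
    ltrProd f l = ltrProd f m := by
  induction l, h using Nat.le_induction with
  | base => rfl
  | succ l hl ih => rw [ltrProd_succ, hf l hl, mul_one, ih]

theorem rtlProd_stable {f : ℕ → H} {m l : ℕ} (hf : ∀ p, m ≤ p → f p = 1) (h : m ≤ l) :
    rtlProd f l = rtlProd f m := by
  induction l, h using Nat.le_induction with
  | base => rfl
  | succ l hl ih => rw [rtlProd_succ, hf l hl, one_mul, ih]

theorem mul_ltrProd {f f' : ℕ → H} {g : H} (h : ∀ p, g * f p = f' p * g) (l : ℕ) :
    g * ltrProd f l = ltrProd f' l * g := by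
  induction l with
  | zero => simp [ltrProd_zero]
  | succ l ih => rw [ltrProd_succ, ltrProd_succ, ← mul_assoc, ih, mul_assoc, h, mul_assoc]

theorem rtlProd_mul {f f' : ℕ → H} {g : H} (h : ∀ p, f p * g = g * f' p) (l : ℕ) :
    rtlProd f l * g = g * rtlProd f' l := by
  induction l with
  | zero => simp [rtlProd_zero]
  | succ l ih => rw [rtlProd_succ, rtlProd_succ, mul_assoc, ih, ← mul_assoc, h, mul_assoc]

/-- If the factors commute and those from `m` on are trivial, then the product over any list without
repetitions which contains all `p < m` is the ordered product up to `m`. -/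
theorem list_prod_eq_ltrProd {f : ℕ → H} {m : ℕ} (hf : ∀ p, m ≤ p → f p = 1)
    (hcomm : ∀ p q, f p * f q = f q * f p) {l : List ℕ} (hl : l.Nodup) (hml : ∀ p < m, p ∈ l) :
    (l.map f).prod = ltrProd f m := by
  have h1 : ∀ l : List ℕ, (l.map f).prod = ((l.filter (· < m)).map f).prod := by
    intro l
    induction l with
    | nil => rfl
    | cons p l ih =>
      by_cases hp : p < m
      · simp [hp, ih]
      · simp [hp, ih, hf p (not_lt.1 hp)]
  rw [h1, ltrProd]
  refine List.Perm.prod_eq' (List.Perm.map f ?_) ?_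
  · refine (List.perm_ext_iff_of_nodup (hl.filter _) List.nodup_range).2 fun p => ?_
    simp only [List.mem_filter, decide_eq_true_eq, List.mem_range]
    exact ⟨And.right, fun hp => ⟨hml p hp, hp⟩⟩
  · exact List.pairwise_map.2 (List.pairwise_of_forall fun p q => hcomm p q)

theorem mul_mul_of_eq {x y a b c : H} (h : x * y = a * (b * c)) (t : H) :
    x * (y * t) = a * (b * (c * t)) := by
  rw [← mul_assoc, h]
  simp only [mul_assoc]

theorem mul_mul_of_mul_mul_eq {x y p p' : H} (h : x * y * p = p' * (x * y)) (t : H) :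
    x * (y * (p * t)) = p' * (x * (y * t)) := by
  rw [← mul_assoc, ← mul_assoc, h]
  simp only [mul_assoc]

theorem mul_mul_of_eq_mul_mul {x y q q' : H} (h : q * (x * y) = x * y * q') (t : H) :
    q * (x * (y * t)) = x * (y * (q' * t)) := by
  rw [← mul_assoc x, ← mul_assoc q, h]
  simp only [mul_assoc]

end OrderedProducts

/-- A family `d a b s` of elements of a monoid which behaves like the images of the powers
`[a n + b n']^s` in a group `G_L`, where `{n', n} = c⁻¹`: powers of one element multiply as
expected, the pentagon relation holds, elements with parallel indices commute, and `d a b s` is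
trivial for large `a + b`. As `{a n + b n', a' n + b' n'} = (b a' - a b') / c`, the hypotheses
`b a' = a b' + k` and `k s = c` of the pentagon relation say that this form is `s⁻¹`. -/
structure IsDilogSystem {H : Type*} [Monoid H] (d : ℕ → ℕ → ℚ → H) (c : ℚ) (K : ℕ) : Prop where
  pow_add : ∀ a b s t, d a b (s + t) = d a b s * d a b t
  pentagon : ∀ {a b a' b' a'' b'' k : ℕ} {s : ℚ}, 0 < k → b * a' = a * b' + k → a'' = a + a' →
    b'' = b + b' → k * s = c → d a b s * d a' b' s = d a' b' s * (d a'' b'' s * d a b s)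
  commute : ∀ {a b a' b' : ℕ} (s t : ℚ), b * a' = a * b' → d a b s * d a' b' t = d a' b' t * d a b s
  eq_one : ∀ {a b : ℕ} (s : ℚ), K ≤ a + b → d a b s = 1
  pos : 0 < K

namespace IsDilogSystem

variable {H : Type*} [Monoid H] {d : ℕ → ℕ → ℚ → H} {c : ℚ} {K : ℕ}

theorem pow_two_mul (hd : IsDilogSystem d c K) (a b : ℕ) (s : ℚ) :
    d a b (2 * s) = d a b s * d a b s := by
  rw [two_mul, hd.pow_add]

theorem pow_four_mul (hd : IsDilogSystem d c K) (a b : ℕ) (s : ℚ) :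
    d a b (4 * s) = d a b s * (d a b s * (d a b s * d a b s)) := by
  rw [show 4 * s = 2 * (2 * s) by ring, hd.pow_two_mul, hd.pow_two_mul, mul_assoc]

/-- `x² y² = y z² (w y) z² w x²` if `x y = y z x` and `x z = z w x`. The recursion for the relation of
type `A₁⁽¹⁾` consists in expanding the factor `w y`, the only one in which the order is still the
initial one. -/
theorem sq_mul_sq {x y z w : H} (h1 : x * y = y * (z * x)) (h2 : x * z = z * (w * x)) :
    x * x * (y * y) = y * (z * (z * (w * y * (z * (z * (w * (x * x))))))) := by
  simp only [mul_assoc, h1, mul_mul_of_eq h1]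
  rw [mul_mul_of_eq h2, mul_mul_of_eq h1, mul_mul_of_eq h2]

/-- The consistency relation of type `A₁⁽¹⁾`: for `v = (a, b)` and `w = (a', b')` with
`{w, v} = s⁻¹`, it expresses `[w]^{2s} [v]^{2s}` as an ordered product. By the pentagon relation,
`[w]^{2s} [v]^{2s}` equals `[v]^s [v+w]^{2s} ([v+2w]^s [v]^s) [v+w]^{2s} [v+2w]^s [w]^{2s}`, where
the factor in parentheses is of the same form with `v + 2w` in place of `w` and `s / 2` in place of
`s`; the recursion ends because `d` is trivial in large degrees. -/
theorem affine_two_two (hd : IsDilogSystem d c K) {a b : ℕ} (l : ℕ) (hl : K ≤ l) :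
    ∀ {a' b' k : ℕ} {s : ℚ}, 0 < k → b' * a = a' * b + k → k * s = c →
    d a' b' (2 * s) * d a b (2 * s) =
      ltrProd (fun p => d ((p + 1) * a + p * a') ((p + 1) * b + p * b') (2 * s)) l *
      (ltrProd (fun p => d (2 ^ p * (a + a')) (2 ^ p * (b + b')) (4 * s / 2 ^ p)) l *
      rtlProd (fun p => d (p * a + (p + 1) * a') (p * b + (p + 1) * b') (2 * s)) l) := by
  -- induction on a bound `m` for `K - (a' + b')`; for `m = 0` the element `[w]` itself is trivial
  suffices H : ∀ m a' b' k : ℕ, ∀ s : ℚ, K ≤ a' + b' + m → 0 < k → b' * a = a' * b + k → k * s = c →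
      d a' b' (2 * s) * d a b (2 * s) =
      ltrProd (fun p => d ((p + 1) * a + p * a') ((p + 1) * b + p * b') (2 * s)) l *
      (ltrProd (fun p => d (2 ^ p * (a + a')) (2 ^ p * (b + b')) (4 * s / 2 ^ p)) l *
      rtlProd (fun p => d (p * a + (p + 1) * a') (p * b + (p + 1) * b') (2 * s)) l) from
    fun {a' b' k s} => H K a' b' k s (by omega)
  intro m
  induction m with
  | zero =>
    intro a' b' k s hm hk hdet hs
    have hm' : K ≤ a' + b' := hm
    have e1 : ltrProd (fun p => d ((p + 1) * a + p * a') ((p + 1) * b + p * b') (2 * s)) l =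
        d a b (2 * s) := by
      rw [ltrProd_stable (m := 1) _ (hd.pos.trans_le hl), ltrProd_succ', ltrProd_zero]
      · simp
      · intro p hp
        exact hd.eq_one _ (by nlinarith)
    have e2 : ltrProd (fun p => d (2 ^ p * (a + a')) (2 ^ p * (b + b')) (4 * s / 2 ^ p)) l = 1 := by
      rw [ltrProd_stable (m := 0) _ (Nat.zero_le l), ltrProd_zero]
      intro p _
      have := Nat.one_le_two_pow (n := p)
      exact hd.eq_one _ (by nlinarith)
    have e3 : rtlProd (fun p => d (p * a + (p + 1) * a') (p * b + (p + 1) * b') (2 * s)) l = 1 := by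
      rw [rtlProd_stable (m := 0) _ (Nat.zero_le l), rtlProd_zero]
      intro p _
      exact hd.eq_one _ (by nlinarith)
    rw [e1, e2, e3, hd.eq_one _ hm', mul_one, mul_one, one_mul]
  | succ m ih =>
    intro a' b' k s hm hk hdet hs
    have hab : 0 < a + b := by
      rcases Nat.eq_zero_or_pos (a + b) with h | h
      · have ha : a = 0 := by omega
        subst ha
        omega
      · exact h
    have hab' : 0 < a' + b' := by
      rcases Nat.eq_zero_or_pos (a' + b') with h | h
      · have hb : b' = 0 := by omega
        subst hb
        omega
      · exact h
    -- the relation for `[v + 2w]^s [v]^s`, where `v + 2w` has larger degree than `w`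
    have IH := ih (a + 2 * a') (b + 2 * b') (2 * k) (s / 2) (by omega) (by omega)
      (by linear_combination 2 * hdet) (by push_cast; linear_combination hs)
    rw [show 2 * (s / 2) = s by ring] at IH
    -- `X j` and `Y j` are the powers of exponent `s` at `(j+1) v + j w` and `j v + (j+1) w`.
    set X : ℕ → H := fun j => d ((j + 1) * a + j * a') ((j + 1) * b + j * b') s with hX
    set Y : ℕ → H := fun j => d (j * a + (j + 1) * a') (j * b + (j + 1) * b') s with hY
    set C : H := d (a + a') (b + b') s with hC
    have hCX : ∀ j, C * X j = X j * (X (j + 1) * C) := fun j =>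
      hd.pentagon hk (by linear_combination hdet) (by ring) (by ring) hs
    have hYC : ∀ j, Y j * C = C * (Y (j + 1) * Y j) := fun j =>
      hd.pentagon hk (by linear_combination hdet) (by ring) (by ring) hs
    have hY0 : d a' b' s = Y 0 := by simp [hY]
    have hX0 : d a b s = X 0 := by simp [hX]
    have hYX : Y 0 * X 0 = X 0 * (C * Y 0) := by
      rw [← hY0, ← hX0]
      exact hd.pentagon hk hdet (by ring) (by ring) hs
    have hY1 : d (a + 2 * a') (b + 2 * b') s = Y 1 := by
      simp only [hY]
      congr 1 <;> ring
    rw [hX0, hY1] at IH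
    have f1 : ltrProd (fun p => d ((p + 1) * a + p * (a + 2 * a')) ((p + 1) * b + p * (b + 2 * b')) s) l
        = ltrProd (fun p => X (2 * p)) l := by
      congr 1
      funext p
      simp only [hX]
      congr 1 <;> ring
    have f2 : rtlProd (fun p => d (p * a + (p + 1) * (a + 2 * a')) (p * b + (p + 1) * (b + 2 * b')) s) l
        = rtlProd (fun p => Y (2 * p + 1)) l := by
      congr 1
      funext p
      simp only [hY]
      congr 1 <;> ring
    have f3 : ltrProd (fun p => d (2 ^ p * (a + (a + 2 * a'))) (2 ^ p * (b + (b + 2 * b')))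
        (4 * (s / 2) / 2 ^ p)) l = ltrProd (fun p => d (2 ^ (p + 1) * (a + a'))
          (2 ^ (p + 1) * (b + b')) (4 * s / 2 ^ (p + 1))) l := by
      congr 1
      funext p
      congr 1
      · ring
      · ring
      · field_simp
        ring
    rw [f1, f2, f3] at IH
    set M : H := ltrProd (fun p => d (2 ^ (p + 1) * (a + a')) (2 ^ (p + 1) * (b + b'))
      (4 * s / 2 ^ (p + 1))) l with hM
    have hCM : C * M = M * C := mul_ltrProd (fun p => hd.commute _ _ (by ring)) l
    -- moving `C²` through the left and the right product
    have g1 : C * C * ltrProd (fun p => X (2 * p)) l =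
        ltrProd (fun p => X (2 * p) * (X (2 * p + 1) * (X (2 * p + 1) * X (2 * p + 2)))) l *
          (C * C) := by
      refine mul_ltrProd (fun p => ?_) l
      simp only [mul_assoc, hCX, mul_mul_of_eq (hCX _)]
    have g2 : rtlProd (fun p => Y (2 * p + 1)) l * (C * C) =
        (C * C) * rtlProd (fun p =>
          Y (2 * p + 3) * (Y (2 * p + 2) * (Y (2 * p + 2) * Y (2 * p + 1)))) l := by
      refine rtlProd_mul (fun p => ?_) l
      simp only [mul_assoc, hYC, mul_mul_of_eq (hYC _)]
    have g3 : ∀ l, X 0 *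
        ltrProd (fun p => X (2 * p) * (X (2 * p + 1) * (X (2 * p + 1) * X (2 * p + 2)))) l =
        ltrProd (fun j => X j * X j) (2 * l) * X (2 * l) := by
      intro l
      induction l with
      | zero => simp [ltrProd_zero]
      | succ l ih =>
        rw [ltrProd_succ, ← mul_assoc, ih, show 2 * (l + 1) = 2 * l + 1 + 1 by ring, ltrProd_succ,
          ltrProd_succ]
        simp only [mul_assoc]
    have g4 : ∀ l, rtlProd (fun p =>
          Y (2 * p + 3) * (Y (2 * p + 2) * (Y (2 * p + 2) * Y (2 * p + 1)))) l *
          (Y 1 * (Y 0 * Y 0)) = Y (2 * l + 1) * rtlProd (fun j => Y j * Y j) (2 * l + 1) := by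
      intro l
      induction l with
      | zero => simp [rtlProd_zero, rtlProd_succ]
      | succ l ih =>
        rw [rtlProd_succ, mul_assoc, ih, show 2 * (l + 1) + 1 = 2 * l + 1 + 1 + 1 by ring,
          rtlProd_succ _ (2 * l + 1 + 1), rtlProd_succ _ (2 * l + 1)]
        simp only [mul_assoc]
    have hXone : ∀ j, K ≤ j → X j = 1 := fun j hj => hd.eq_one _ (by nlinarith)
    have hYone : ∀ j, K ≤ j → Y j = 1 := fun j hj => hd.eq_one _ (by nlinarith)
    -- the factors left over in `g3` and `g4` have large degree, hence are trivial
    have k1 : ltrProd (fun p => d ((p + 1) * a + p * a') ((p + 1) * b + p * b') (2 * s)) l =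
        ltrProd (fun j => X j * X j) (2 * l) * X (2 * l) := by
      rw [hXone (2 * l) (by omega), mul_one,
        ltrProd_stable (f := fun j => X j * X j) (l := 2 * l) (m := l)
          (fun p hp => by rw [hXone p (hl.trans hp), mul_one]) (by omega)]
      congr 1
      funext p
      exact hd.pow_two_mul _ _ _
    have k2 : rtlProd (fun p => d (p * a + (p + 1) * a') (p * b + (p + 1) * b') (2 * s)) l =
        Y (2 * l + 1) * rtlProd (fun j => Y j * Y j) (2 * l + 1) := by
      rw [hYone (2 * l + 1) (by omega), one_mul,
        rtlProd_stable (f := fun j => Y j * Y j) (l := 2 * l + 1) (m := l)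
          (fun p hp => by rw [hYone p (hl.trans hp), mul_one]) (by omega)]
      congr 1
      funext p
      exact hd.pow_two_mul _ _ _
    have k3 : ltrProd (fun p => d (2 ^ p * (a + a')) (2 ^ p * (b + b')) (4 * s / 2 ^ p)) l =
        C * (C * (C * C)) * M := by
      rw [← ltrProd_stable (m := l) (l := l + 1) (fun p hp => hd.eq_one _ ?_) (by omega),
        ltrProd_succ', ← hM, hC, ← hd.pow_four_mul]
      · simp
      · have := Nat.lt_two_pow_self (n := p)
        nlinarith
    rw [k1, k2, k3, hd.pow_two_mul, hd.pow_two_mul, hY0, hX0, ← g3, ← g4, sq_mul_sq hYX (hYC 0), IH]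
    have g1' := mul_mul_of_mul_mul_eq g1
    have g2' := mul_mul_of_eq_mul_mul g2
    have hCM' : ∀ t, C * (M * t) = M * (C * t) := fun t => by
      rw [← mul_assoc, hCM, mul_assoc]
    simp only [mul_assoc, g1', g2', hCM, hCM']

/-- The consistency relation `[w]^c [v]^{4c}` for `v = (1, 0)`, `w = (0, 1)`. Applications of the
pentagon relation give, in the notation `ij` for `d i j c`,
`01 · 10⁴ = 10³ · 31 · 21³ · (32 · 10) · 21³ · 53 · 32³ · 43 · 11⁴ · 01`. The factor in parentheses
is expanded by `affine_two_two`; then `21³` is moved through its two outer products. -/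
theorem affine_one_four (hd : IsDilogSystem d c K) (l : ℕ) (hl : K ≤ l) :
    d 0 1 c * d 1 0 (4 * c) =
      ltrProd (fun p => d (2 * p + 1) p (4 * c) * d (4 * p + 4) (2 * p + 1) c) l *
      d 2 1 (2 * c) * ltrProd (fun p => d (2 ^ p * 2) (2 ^ p) (4 * c / 2 ^ p)) l *
      rtlProd (fun p => d (2 * p + 1) (p + 1) (4 * c) * d (4 * p) (2 * p + 1) c) l := by
  -- `V q`, `U q` and `S q`, `R q` are the elements of exponent `c` below and above the ray of `21`.
  set V : ℕ → H := fun q => d (2 * q + 1) q c with hV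
  set U : ℕ → H := fun q => d (4 * q + 4) (2 * q + 1) c with hU
  set R : ℕ → H := fun q => d (2 * q + 1) (q + 1) c with hR
  set S : ℕ → H := fun q => d (4 * q) (2 * q + 1) c with hS
  set E : H := d 2 1 c with hE
  have pent : ∀ {a b a' b' a'' b'' : ℕ}, b * a' = a * b' + 1 → a'' = a + a' → b'' = b + b' →
      d a b c * d a' b' c = d a' b' c * (d a'' b'' c * d a b c) := fun h h1 h2 =>
    hd.pentagon one_pos h h1 h2 (by simp)
  have hEV : ∀ q, E * V q = V q * (V (q + 1) * E) := fun q => pent (by ring) (by ring) (by ring)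
  have hVV : ∀ q, V (q + 1) * V q = V q * (U q * V (q + 1)) := fun q =>
    pent (by ring) (by ring) (by ring)
  have hRE : ∀ q, R q * E = E * (R (q + 1) * R q) := fun q => pent (by ring) (by ring) (by ring)
  have hRR : ∀ q, R q * R (q + 1) = R (q + 1) * (S (q + 1) * R q) := fun q =>
    pent (by ring) (by ring) (by ring)
  -- the expansion of `01 · 10⁴`
  have hBA : S 0 * V 0 = V 0 * (R 0 * S 0) := pent rfl rfl rfl
  have hDA : R 0 * V 0 = V 0 * (E * R 0) := pent rfl rfl rfl
  have expand : S 0 * (V 0 * (V 0 * (V 0 * V 0))) =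
      V 0 * (V 0 * (V 0 * (V 1 * (E * (E * (E * (R 1 * (V 0 * (E * (E * (E * (R 2 * (R 1 *
        (R 1 * (R 1 * (S 1 * (R 0 * (R 0 * (R 0 * (R 0 * S 0)))))))))))))))))))) := by
    have hDE := hRE 0
    have hHE := hRE 1
    have hDH := hRR 0
    have hEA := hEV 0
    simp only [zero_add, one_add_one_eq_two] at hDE hHE hDH hEA
    -- The elements of larger slope are moved to the right, except in the pair `R 1 * V 0`.
    simp only [hBA, mul_mul_of_eq hBA]
    simp only [mul_mul_of_eq hDA]
    simp only [mul_mul_of_eq hDE]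
    simp only [mul_mul_of_eq hDA]
    simp only [mul_mul_of_eq hDE]
    simp only [mul_mul_of_eq hDH]
    simp only [mul_mul_of_eq hHE]
    simp only [mul_mul_of_eq hEA]
  set M : H := ltrProd (fun p => d (2 ^ (p + 1) * 2) (2 ^ (p + 1)) (4 * c / 2 ^ (p + 1))) l with hM
  have hHA : R 1 * V 0 = ltrProd (fun p => V (2 * p)) l *
      (M * rtlProd (fun p => R (2 * p + 1)) l) := by
    have key := hd.affine_two_two (a := 1) (b := 0) l hl (a' := 3) (b' := 2) (k := 2) (s := c / 2)
      two_pos rfl (by push_cast; ring)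
    rw [show 2 * (c / 2) = c by ring] at key
    have f1 : ltrProd (fun p => V (2 * p)) l =
        ltrProd (fun p => d ((p + 1) * 1 + p * 3) ((p + 1) * 0 + p * 2) c) l := by
      congr 1
      funext p
      simp only [hV]
      congr 1 <;> ring
    have f2 : M = ltrProd (fun p => d (2 ^ p * (1 + 3)) (2 ^ p * (0 + 2))
        (4 * (c / 2) / 2 ^ p)) l := by
      rw [hM]
      congr 1
      funext p
      congr 1 <;> ring
    have f3 : rtlProd (fun p => R (2 * p + 1)) l =
        rtlProd (fun p => d (p * 1 + (p + 1) * 3) (p * 0 + (p + 1) * 2) c) l := by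
      congr 1
      funext p
      simp only [hR]
      congr 1 <;> ring
    rw [f1, f2, f3]
    exact key
  have hEM : E * M = M * E :=
    mul_ltrProd (fun p => hd.commute _ _ (by ring)) l
  -- moving `21³` through the left and the right product
  have g1 : E * (E * E) * ltrProd (fun p => V (2 * p)) l =
      ltrProd (fun p => V (2 * p) * (V (2 * p + 1) * (V (2 * p + 1) * (V (2 * p + 1) *
        (U (2 * p + 1) * (V (2 * p + 2) * (V (2 * p + 2) * (V (2 * p + 2) * V (2 * p + 3)))))))))
        l * (E * (E * E)) := by
    refine mul_ltrProd (fun p => ?_) l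
    simp only [mul_assoc, hEV, mul_mul_of_eq (hEV _)]
    rw [mul_mul_of_eq (hVV (2 * p + 1))]
  have g2 : rtlProd (fun p => R (2 * p + 1)) l * (E * (E * E)) =
      E * (E * E) * rtlProd (fun p => R (2 * p + 4) * (R (2 * p + 3) * (R (2 * p + 3) *
        (R (2 * p + 3) * (S (2 * p + 3) * (R (2 * p + 2) * (R (2 * p + 2) * (R (2 * p + 2) *
          R (2 * p + 1))))))))) l := by
    refine rtlProd_mul (fun p => ?_) l
    simp only [mul_assoc, hRE, mul_mul_of_eq (hRE _)]
    rw [mul_mul_of_eq (hRR (2 * p + 2))]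
  have g3 : ∀ l, V 0 * (V 0 * (V 0 * V 1)) *
      ltrProd (fun p => V (2 * p) * (V (2 * p + 1) * (V (2 * p + 1) * (V (2 * p + 1) *
        (U (2 * p + 1) * (V (2 * p + 2) * (V (2 * p + 2) * (V (2 * p + 2) * V (2 * p + 3)))))))))
        l = ltrProd (fun q => V q * (V q * (V q * V q)) * U q) (2 * l) *
          (V (2 * l) * (V (2 * l) * (V (2 * l) * V (2 * l + 1)))) := by
    intro l
    induction l with
    | zero => simp [ltrProd_zero]
    | succ l ih =>
      rw [ltrProd_succ, ← mul_assoc, ih, show 2 * (l + 1) = 2 * l + 1 + 1 by ring, ltrProd_succ,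
        ltrProd_succ]
      simp only [mul_assoc, mul_mul_of_eq (hVV (2 * l))]
  have g4 : ∀ l, rtlProd (fun p => R (2 * p + 4) * (R (2 * p + 3) * (R (2 * p + 3) *
        (R (2 * p + 3) * (S (2 * p + 3) * (R (2 * p + 2) * (R (2 * p + 2) * (R (2 * p + 2) *
          R (2 * p + 1))))))))) l *
      (R 2 * (R 1 * (R 1 * (R 1 * (S 1 * (R 0 * (R 0 * (R 0 * (R 0 * S 0))))))))) =
      R (2 * l + 2) * (R (2 * l + 1) * (R (2 * l + 1) * (R (2 * l + 1) * S (2 * l + 1)))) *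
        rtlProd (fun q => R q * (R q * (R q * R q)) * S q) (2 * l + 1) := by
    intro l
    induction l with
    | zero => simp [rtlProd_zero, rtlProd_succ, mul_assoc]
    | succ l ih =>
      rw [rtlProd_succ, mul_assoc, ih, show 2 * (l + 1) + 1 = 2 * l + 1 + 1 + 1 by ring,
        rtlProd_succ _ (2 * l + 1 + 1), rtlProd_succ _ (2 * l + 1)]
      simp only [mul_assoc, mul_mul_of_eq (hRR (2 * l + 1))]
      rfl
  -- the factors left over in `g3` and `g4` have large degree, hence are trivial
  have hVone : ∀ j, K ≤ j → V j = 1 := fun j hj => hd.eq_one _ (by omega)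
  have hUone : ∀ j, K ≤ j → U j = 1 := fun j hj => hd.eq_one _ (by omega)
  have hRone : ∀ j, K ≤ j → R j = 1 := fun j hj => hd.eq_one _ (by omega)
  have hSone : ∀ j, K ≤ j → S j = 1 := fun j hj => hd.eq_one _ (by omega)
  have k1 : ltrProd (fun p => d (2 * p + 1) p (4 * c) * U p) l =
      ltrProd (fun q => V q * (V q * (V q * V q)) * U q) (2 * l) *
          (V (2 * l) * (V (2 * l) * (V (2 * l) * V (2 * l + 1)))) := by
    rw [hVone (2 * l) (by omega), hVone (2 * l + 1) (by omega),
      ltrProd_stable (f := fun q => V q * (V q * (V q * V q)) * U q) (m := l) (l := 2 * l)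
        (fun p hp => by simp [hVone p (hl.trans hp), hUone p (hl.trans hp)]) (by omega)]
    simp only [mul_one]
    congr 1
    funext p
    rw [hd.pow_four_mul]
  have k2 : rtlProd (fun p => d (2 * p + 1) (p + 1) (4 * c) * S p) l =
      R (2 * l + 2) * (R (2 * l + 1) * (R (2 * l + 1) * (R (2 * l + 1) * S (2 * l + 1)))) *
        rtlProd (fun q => R q * (R q * (R q * R q)) * S q) (2 * l + 1) := by
    rw [hRone (2 * l + 1) (by omega), hRone (2 * l + 2) (by omega), hSone (2 * l + 1) (by omega),
      rtlProd_stable (f := fun q => R q * (R q * (R q * R q)) * S q) (m := l) (l := 2 * l + 1)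
        (fun p hp => by simp [hRone p (hl.trans hp), hSone p (hl.trans hp)]) (by omega)]
    simp only [one_mul]
    congr 1
    funext p
    rw [hd.pow_four_mul]
  have k3 : ltrProd (fun p => d (2 ^ p * 2) (2 ^ p) (4 * c / 2 ^ p)) l =
      E * (E * (E * E)) * M := by
    rw [← ltrProd_stable (m := l) (l := l + 1) (fun p hp => hd.eq_one _ ?_) (by omega),
      ltrProd_succ', ← hM, hE, ← hd.pow_four_mul]
    · simp
    · have := Nat.lt_two_pow_self (n := p)
      omega
  have hB : d 0 1 c = S 0 := rfl
  have hA : d 1 0 c = V 0 := rfl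
  have g1' := mul_mul_of_mul_mul_eq g1
  have g2' := mul_mul_of_eq_mul_mul g2
  have hEM' : ∀ t, E * (M * t) = M * (E * t) := fun t => by
    rw [← mul_assoc, hEM, mul_assoc]
  have hHA' : ∀ t, R 1 * (V 0 * t) = ltrProd (fun p => V (2 * p)) l *
      (M * (rtlProd (fun p => R (2 * p + 1)) l * t)) := fun t => by
    rw [← mul_assoc, hHA]
    simp only [mul_assoc]
  rw [hd.pow_four_mul, hd.pow_two_mul 2 1, ← hE, hB, hA, expand, hHA', k1, k2, k3, ← g3, ← g4]
  simp only [mul_assoc] at g1' g2' ⊢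
  simp only [g1', g2', hEM']

end IsDilogSystem

/-! ### Infinite products in `G` -/

namespace ClusterScattering.SkewLattice

section Limits

variable {N : Type*} [AddCommGroup N] {D : SkewLattice N} {𝕜 : Type*} [Field 𝕜] [CharZero 𝕜]

theorem G.proj_list_prod (L : D.Cut) (l : List (D.G 𝕜)) :
    G.proj L l.prod = (l.map (G.proj L)).prod := by
  induction l with
  | nil => rfl
  | cons g l ih =>
    rw [List.prod_cons, List.map_cons, List.prod_cons, G.proj_mul, ih]

/-- A sequence in `G` whose image in each `G_L` is eventually constant converges. -/
theorem G.exists_limit {u : ℕ → D.G 𝕜}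
    (hu : ∀ L : D.Cut, ∃ m, ∀ l, m ≤ l → G.proj L (u l) = G.proj L (u m)) :
    ∃ P : D.G 𝕜, ∀ L : D.Cut, ∀ᶠ l in Filter.atTop, G.proj L (u l) = G.proj L P := by
  choose m hm using hu
  refine ⟨⟨fun L => G.proj L (u (m L)), fun L L' h => ?_⟩, fun L => ?_⟩
  · change Cut.transGrp 𝕜 h (G.proj L (u (m L))) = G.proj L' (u (m L'))
    rw [← hm L _ (le_max_left (m L) (m L')), ← hm L' _ (le_max_right (m L) (m L'))]
    exact (u _).2 L L' h
  · filter_upwards [Filter.eventually_ge_atTop (m L)] with l hl using hm L l hl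

theorem exists_isProdRight (hD : ∃ m n : D.Pos, D.pform m n ≠ 0) {a : ℕ → D.G 𝕜}
    (ha : ∀ L : D.Cut, ∃ m, ∀ p, m ≤ p → G.proj L (a p) = 1) : ∃ P, IsProdRight a P := by
  refine G.exists_limit fun L => ?_
  let := Cut.grpMonoid (𝕜 := 𝕜) hD L
  obtain ⟨m, hm⟩ := ha L
  refine ⟨m, fun l hl => ?_⟩
  rw [G.proj_list_prod, G.proj_list_prod, List.map_map, List.map_map]
  exact ltrProd_stable hm hl

theorem exists_isProdLeft (hD : ∃ m n : D.Pos, D.pform m n ≠ 0) {a : ℕ → D.G 𝕜}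
    (ha : ∀ L : D.Cut, ∃ m, ∀ p, m ≤ p → G.proj L (a p) = 1) : ∃ P, IsProdLeft a P := by
  refine G.exists_limit fun L => ?_
  let := Cut.grpMonoid (𝕜 := 𝕜) hD L
  obtain ⟨m, hm⟩ := ha L
  refine ⟨m, fun l hl => ?_⟩
  rw [G.proj_list_prod, G.proj_list_prod, List.map_map, List.map_map]
  exact rtlProd_stable hm hl

theorem IsProdRight.isProdUnordered (hD : ∃ m n : D.Pos, D.pform m n ≠ 0) {a : ℕ → D.G 𝕜}
    (ha : ∀ L : D.Cut, ∃ m, ∀ p, m ≤ p → G.proj L (a p) = 1)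
    (hcomm : ∀ p q, a p * a q = a q * a p) {P : D.G 𝕜} (hP : IsProdRight a P) :
    IsProdUnordered a P := by
  intro L
  let := Cut.grpMonoid (𝕜 := 𝕜) hD L
  obtain ⟨m, hm⟩ := ha L
  refine ⟨Finset.range m, fun l hl hml => ?_⟩
  obtain ⟨k, hk, hmk⟩ := ((hP L).and (Filter.eventually_ge_atTop m)).exists
  rw [← hk, G.proj_list_prod, G.proj_list_prod, List.map_map, List.map_map]
  refine Eq.trans ?_ (ltrProd_stable hm hmk).symm
  exact list_prod_eq_ltrProd hm (fun p q => congrArg (G.proj L) (hcomm p q)) hl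
    fun p hp => hml p (Finset.mem_range.2 hp)

/-- The image of `[a n + b n']^s` in `G_L`, and `1` for `a = b = 0`. -/
noncomputable def combPow (𝕜 : Type*) [Field 𝕜] [CharZero 𝕜] (L : D.Cut) (n n' : D.Pos) (a b : ℕ)
    (s : ℚ) : L.Grp 𝕜 :=
  if h : 0 < a + b then G.proj L (dilog 𝕜 (n.comb n' a b h) ^ s) else 1

theorem combPow_of_pos (L : D.Cut) (n n' : D.Pos) {a b : ℕ} (h : 0 < a + b) (s : ℚ) :
    combPow 𝕜 L n n' a b s = G.proj L (dilog 𝕜 (n.comb n' a b h) ^ s) := dif_pos h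

theorem pform_comb (n n' : D.Pos) {a b a' b' : ℕ} (h : 0 < a + b) (h' : 0 < a' + b') :
    D.pform (n.comb n' a b h) (n.comb n' a' b' h') = (b * a' - a * b') * D.pform n' n := by
  have h1 := D.skew n.1 n'.1
  simp only [pform, Pos.comb, map_add, map_nsmul, LinearMap.add_apply, LinearMap.smul_apply,
    form_self, h1, nsmul_eq_mul]
  ring

theorem le_deg_comb (n n' : D.Pos) {a b : ℕ} (h : 0 < a + b) :
    ((a + b : ℕ) : ℤ) ≤ D.deg (n.comb n' a b h) := by
  have h1 : D.deg (n.comb n' a b h) = a * D.deg n + b * D.deg n' := by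
    simp [deg, Pos.comb]
    ring
  have h2 := deg_pos n
  have h3 := deg_pos n'
  rw [h1]
  push_cast
  nlinarith

theorem exists_proj_comb_eq_one (𝕜 : Type*) [Field 𝕜] [CharZero 𝕜] (L : D.Cut) (n n' : D.Pos) :
    ∃ K : ℕ, 0 < K ∧ ∀ (a b : ℕ) (h : 0 < a + b) (s : ℚ), K ≤ a + b →
      G.proj L (dilog 𝕜 (n.comb n' a b h) ^ s) = 1 := by
  obtain ⟨K, hK⟩ := exists_deg_le L
  refine ⟨K + 1, K.succ_pos, fun a b h s hab => proj_dilog_pow_eq_one ?_ s⟩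
  by_contra hn
  have h1 := hK _ hn
  have h2 := le_deg_comb n n' h
  omega

theorem isDilogSystem_combPow (hD : ∃ m n : D.Pos, D.pform m n ≠ 0) (L : D.Cut) {n n' : D.Pos}
    {c : ℚ} (hc : c ≠ 0) (h : D.pform n' n = c⁻¹) {K : ℕ} (hK : 0 < K)
    (hone : ∀ (a b : ℕ) (h : 0 < a + b) (s : ℚ), K ≤ a + b →
      G.proj L (dilog 𝕜 (n.comb n' a b h) ^ s) = 1) :
    letI := Cut.grpMonoid (𝕜 := 𝕜) hD L
    IsDilogSystem (combPow 𝕜 L n n') c K := by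
  let := Cut.grpMonoid (𝕜 := 𝕜) hD L
  refine ⟨fun a b s t => ?_, ?_, fun {a b a' b'} s t hdet => ?_, fun {a b} s hab => ?_, hK⟩
  · by_cases hab : 0 < a + b
    · simp only [combPow_of_pos L n n' hab, dilog_pow_add hD]
      rfl
    · simp only [combPow, dif_neg hab]
      exact (mul_one _).symm
  · intro a b a' b' a'' b'' k s hk hdet ha hb hs
    have hab : 0 < a + b := by
      by_contra h0
      obtain ⟨rfl, rfl⟩ : a = 0 ∧ b = 0 := by omega
      omega
    have hab' : 0 < a' + b' := by
      by_contra h0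
      obtain ⟨rfl, rfl⟩ : a' = 0 ∧ b' = 0 := by omega
      omega
    have hab'' : 0 < a'' + b'' := by omega
    rw [combPow_of_pos L n n' hab, combPow_of_pos L n n' hab', combPow_of_pos L n n' hab'']
    have hsum : n.comb n' a'' b'' hab'' = n.comb n' a' b' hab' + n.comb n' a b hab := by
      refine Subtype.ext ?_
      subst ha hb
      change (a + a') • n.1 + (b + b') • n'.1 = a' • n.1 + b' • n'.1 + (a • n.1 + b • n'.1)
      module
    have hform : D.pform (n.comb n' a b hab) (n.comb n' a' b' hab') * s = 1 := by
      have hdet' : (b * a' : ℚ) = a * b' + k := by exact_mod_cast hdet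
      rw [pform_comb, h, hdet', add_sub_cancel_left, mul_right_comm, hs,
        mul_inv_cancel₀ hc]
    have := congrArg (G.proj L) (pentagon (𝕜 := 𝕜) hform)
    rw [hsum]
    refine Eq.trans this ?_
    exact mul_assoc _ _ _
  · by_cases hab : 0 < a + b
    · by_cases hab' : 0 < a' + b'
      · rw [combPow_of_pos L n n' hab, combPow_of_pos L n n' hab']
        refine congrArg (G.proj L) (dilog_pow_commute hD s t ?_)
        have hdet' : (b * a' : ℚ) = a * b' := by exact_mod_cast hdet
        rw [pform_comb, hdet', sub_self, zero_mul]
      · rw [combPow.eq_def 𝕜 L n n' a', dif_neg hab']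
        exact (mul_one _).trans (one_mul _).symm
    · rw [combPow.eq_def 𝕜 L n n' a b, dif_neg hab]
      exact (one_mul _).trans (mul_one _).symm
  · rw [combPow_of_pos L n n' (hK.trans_le hab)]
    exact hone a b _ s hab

end Limits

end ClusterScattering.SkewLattice

open ClusterScattering ClusterScattering.SkewLattice in
theorem theorem4p1 {N : Type*} [AddCommGroup N] (D : SkewLattice N)
    (𝕜 : Type*) [Field 𝕜] [CharZero 𝕜] (n n' : D.Pos) (c : ℚ) (hc : c ≠ 0)
    (h : D.pform n' n = c⁻¹) :
    ∃ P M Q : D.G 𝕜,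
      IsProdRight (fun p => dilog 𝕜 (n.comb n' (2 * p + 1) p (by omega)) ^ (4 * c) *
        dilog 𝕜 (n.comb n' (4 * p + 4) (2 * p + 1) (by omega)) ^ c) P ∧
      IsProdUnordered (fun p => dilog 𝕜 (n.comb n' (2 ^ p * 2) (2 ^ p) (by positivity)) ^
        (4 * c / 2 ^ p)) M ∧
      IsProdLeft (fun p => dilog 𝕜 (n.comb n' (2 * p + 1) (p + 1) (by omega)) ^ (4 * c) *
        dilog 𝕜 (n.comb n' (4 * p) (2 * p + 1) (by omega)) ^ c) Q ∧
      dilog 𝕜 n' ^ c * dilog 𝕜 n ^ (4 * c) =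
        P * dilog 𝕜 (n.comb n' 2 1 (by omega)) ^ (2 * c) * M * Q := by
  have hD : ∃ m n : D.Pos, D.pform m n ≠ 0 := ⟨n', n, by rw [h]; exact inv_ne_zero hc⟩
  choose K hKpos hK using fun L : D.Cut => exists_proj_comb_eq_one 𝕜 L n n'
  have one_mul_one : ∀ (L : D.Cut) {g g' : D.G 𝕜}, G.proj L g = 1 → G.proj L g' = 1 →
      G.proj L (g * g') = 1 := fun L g g' hg hg' => by
    let := Cut.grpMonoid (𝕜 := 𝕜) hD L
    rw [G.proj_mul, hg, hg']
    exact mul_one (1 : L.Grp 𝕜)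
  obtain ⟨P, hP⟩ := exists_isProdRight (𝕜 := 𝕜) hD
    (a := fun p => dilog 𝕜 (n.comb n' (2 * p + 1) p (by omega)) ^ (4 * c) *
        dilog 𝕜 (n.comb n' (4 * p + 4) (2 * p + 1) (by omega)) ^ c)
    fun L => ⟨K L, fun p hp => one_mul_one L (hK L _ _ _ _ (by omega)) (hK L _ _ _ _ (by omega))⟩
  obtain ⟨Q, hQ⟩ := exists_isProdLeft (𝕜 := 𝕜) hD
    (a := fun p => dilog 𝕜 (n.comb n' (2 * p + 1) (p + 1) (by omega)) ^ (4 * c) *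
        dilog 𝕜 (n.comb n' (4 * p) (2 * p + 1) (by omega)) ^ c)
    fun L => ⟨K L, fun p hp => one_mul_one L (hK L _ _ _ _ (by omega)) (hK L _ _ _ _ (by omega))⟩
  have hone : ∀ L : D.Cut, ∃ m, ∀ p, m ≤ p → G.proj L
      (dilog 𝕜 (n.comb n' (2 ^ p * 2) (2 ^ p) (by positivity)) ^ (4 * c / 2 ^ p)) = 1 := fun L =>
    ⟨K L, fun p hp => hK L _ _ _ _ (by have := Nat.lt_two_pow_self (n := p); omega)⟩
  obtain ⟨M, hM⟩ := exists_isProdRight (𝕜 := 𝕜) hD hone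
  refine ⟨P, M, Q, hP, hM.isProdUnordered hD hone fun p q => ?_, hQ, G.ext_proj fun L => ?_⟩
  · refine dilog_pow_commute hD _ _ ?_
    rw [pform_comb]
    push_cast
    ring
  let := Cut.grpMonoid (𝕜 := 𝕜) hD L
  obtain ⟨l, ⟨⟨hPl, hMl⟩, hQl⟩, hl⟩ := ((((hP L).and (hM L)).and (hQ L)).and
    (Filter.eventually_ge_atTop (K L))).exists
  have key := (isDilogSystem_combPow hD L hc h (hKpos L) (hK L)).affine_one_four l hl
  have e1 : n.comb n' 0 1 (by omega) = n' := Subtype.ext (by simp [Pos.comb])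
  have e2 : n.comb n' 1 0 (by omega) = n := Subtype.ext (by simp [Pos.comb])
  rw [combPow_of_pos L n n' (by omega : 0 < 0 + 1), combPow_of_pos L n n' (by omega : 0 < 1 + 0),
    combPow_of_pos L n n' (by omega : 0 < 2 + 1), e1, e2] at key
  simp only [G.proj_mul]
  rw [← hPl, ← hMl, ← hQl, G.proj_list_prod, G.proj_list_prod, G.proj_list_prod, List.map_map,
    List.map_map, List.map_map]
  refine key.trans ?_
  have hf1 : (fun p => combPow 𝕜 L n n' (2 * p + 1) p (4 * c) *
      combPow 𝕜 L n n' (4 * p + 4) (2 * p + 1) c) =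
      G.proj L ∘ fun p => dilog 𝕜 (n.comb n' (2 * p + 1) p (by omega)) ^ (4 * c) *
        dilog 𝕜 (n.comb n' (4 * p + 4) (2 * p + 1) (by omega)) ^ c := by
    funext p
    rw [combPow_of_pos, combPow_of_pos]
    rfl
  have hf2 : (fun p => combPow 𝕜 L n n' (2 ^ p * 2) (2 ^ p) (4 * c / 2 ^ p)) =
      G.proj L ∘ fun p => dilog 𝕜 (n.comb n' (2 ^ p * 2) (2 ^ p) (by positivity)) ^
        (4 * c / 2 ^ p) := by
    funext p
    rw [combPow_of_pos]
    rfl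
  have hf3 : (fun p => combPow 𝕜 L n n' (2 * p + 1) (p + 1) (4 * c) *
      combPow 𝕜 L n n' (4 * p) (2 * p + 1) c) =
      G.proj L ∘ fun p => dilog 𝕜 (n.comb n' (2 * p + 1) (p + 1) (by omega)) ^ (4 * c) *
        dilog 𝕜 (n.comb n' (4 * p) (2 * p + 1) (by omega)) ^ c := by
    funext p
    rw [combPow_of_pos, combPow_of_pos]
    rfl
  rw [hf1, hf2, hf3]
  rfl
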